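/- There is an absolute constant $C>0$ such that the following holds. Let $\tau\ge 1$, $d\ge 1$, $m\ge 2$ be integers, let $\varepsilon=\frac1{8k}$ for an integer $k\ge 2$, and let $n=m\,\tau\,(1/(8\varepsilon))^d$. Then there are $n$ points $p_1,\dots,p_n\in\mathbb R$ (one for each of $n$ arms) and a finite collection $\mathcal I$ of closed intervals $[\ell_i,r_i]$ with $\ell_i<r_i$ such that (1) $\tau$ is the minimum cardinality of a finite set $H\subset\mathbb R$ that contains a point of the interior of every interval of $\mathcal I$ (a hitting set); and (2) for every $0<\delta\le\frac12$ and every (possibly randomized, adaptive) algorithm that achieves the $(\varepsilon,\delta)$-PAC guarantee for bandit range searching on this instance, there are reward distributions of the $n$ arms, supported on $[0,1]^d$, under which the expected number of samples drawn by the algorithm is at least $$C\,\frac{n}{\varepsilon^2}\,\log\!\left(\frac{\tau}{\varepsilon^d\,\delta}\right).$$ Here each arm $a$ has an unknown reward distribution supported on $[0,1]^d$, with mean vector (weight) $\mu_a\in[0,1]^d$. An algorithm, which knows the points, the intervals, $\varepsilon$ and $\delta$, repeatedly chooses an arm on the basis of its past observations and its internal randomness and observes an independent draw from that arm's distribution,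 until it stops and returns a set of arms for every interval. For an interval $I$ let $\mathcal A(I)$ be the set of arms $a$ with $p_a\in I$. A set $T\subseteq\mathcal A(I)$ is $\varepsilon$-Pareto optimal for $I$ if for every $b\in\mathcal A(I)$ there is $a\in T$ with $\mu_a\ge\mu_b-\varepsilon\mathbf 1$, and for no $a\in T$ is there $b\in\mathcal A(I)$ with $\mu_b\ge\mu_a+\varepsilon\mathbf 1$ (componentwise inequalities, $\mathbf 1$ the all-ones vector). The algorithm achieves the $(\varepsilon,\delta)$-PAC guarantee on the instance if, for all reward distributions of the arms supported on $[0,1]^d$, with probability at least $1-\delta$ it stops and returns an $\varepsilon$-Pareto optimal set for every interval of $\mathcal I$. -/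

import Mathlib

open MeasureTheory
open scoped ENNReal

namespace BanditRange

/-- The known part of a bandit range searching problem: a point on the line for each of the `n`
arms, and `q` closed intervals with nonempty interior. -/
structure Instance (n q : ℕ) where
  point : Fin n → ℝ
  left : Fin q → ℝ
  right : Fin q → ℝ
  left_lt_right : ∀ i, left i < right i

namespace Instance

variable {n q : ℕ}

/-- The arms whose point lies in the `i`-th interval. -/
def arms (P : Instance n q) (i : Fin q) : Set (Fin n) :=
  {a | P.left i ≤ P.point a ∧ P.point a ≤ P.right i}

/-- A finite set of reals that meets the interior of every interval. -/
def IsHittingSet (P : Instance n q) (H : Finset ℝ) : Prop :=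
  ∀ i, ∃ e ∈ H, P.left i < e ∧ e < P.right i

/-- A minimum-cardinality hitting set of the intervals has exactly `τ` points. -/
def HasHittingNumber (P : Instance n q) (τ : ℕ) : Prop :=
  IsLeast {s : ℕ | ∃ H : Finset ℝ, P.IsHittingSet H ∧ H.card = s} τ

/-- `T` is an `ε`-Pareto optimal set of arms for the `i`-th interval, when the arms have
weight vectors `w`. The order on `Fin d → ℝ` is the componentwise one. -/
def IsParetoOptimal {d : ℕ} (P : Instance n q) (w : Fin n → Fin d → ℝ) (ε : ℝ) (i : Fin q)
    (T : Finset (Fin n)) : Prop :=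
  (∀ a ∈ T, a ∈ P.arms i) ∧
  (∀ b ∈ P.arms i, ∃ a ∈ T, w b - (fun _ => ε) ≤ w a) ∧
  (∀ a ∈ T, ¬ ∃ b ∈ P.arms i, w a + (fun _ => ε) ≤ w b)

end Instance

/-- The unknown part of the problem: for each arm, the distribution of its `d`-dimensional
reward, supported on the unit cube. The coordinates of one reward may be dependent. -/
structure Rewards (n d : ℕ) where
  law : Fin n → ProbabilityMeasure (Fin d → ℝ)
  mem_cube : ∀ a, ∀ᵐ x ∂(law a : Measure (Fin d → ℝ)), ∀ j, x j ∈ Set.Icc (0 : ℝ) 1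

namespace Rewards

variable {n d : ℕ}

/-- The weight of an arm: the mean vector of its reward. -/
noncomputable def weight (ν : Rewards n d) (a : Fin n) : Fin d → ℝ :=
  fun j => ∫ x, x j ∂(ν.law a : Measure (Fin d → ℝ))

/-- The law of a table of independent rewards: entry `(k, a)` is distributed as the reward of
arm `a`, and it is what the `k`-th draw shows if that draw is made from arm `a`. -/
noncomputable def table (ν : Rewards n d) : Measure (ℕ → Fin n → Fin d → ℝ) :=
  Measure.infinitePi (fun _ : ℕ => Measure.pi (fun a => (ν.law a : Measure (Fin d → ℝ))))

end Rewards

/-- A randomized adaptive algorithm. It draws a random seed once. Then, given the seed and the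
list of all (arm, observed reward) pairs so far, in chronological order, it either draws a
sample from a chosen arm (`Sum.inl`), or stops and returns a set of arms for each interval
(`Sum.inr`). Decisions are measurable functions of the seed and the observations. -/
structure Algorithm (n d q : ℕ) where
  Seed : Type
  [measurableSpaceSeed : MeasurableSpace Seed]
  seedLaw : ProbabilityMeasure Seed
  act : Seed → List (Fin n × (Fin d → ℝ)) → Fin n ⊕ (Fin q → Finset (Fin n))
  measurable_act : ∀ (k : ℕ) (x : Fin n ⊕ (Fin q → Finset (Fin n))),
    MeasurableSet
      {p : Seed × (Fin k → Fin n × (Fin d → ℝ)) | act p.1 (List.ofFn p.2) = x}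

namespace Algorithm

variable {n d q : ℕ}

instance (A : Algorithm n d q) : MeasurableSpace A.Seed := A.measurableSpaceSeed

/-- The observations made within the first `k` steps, for a given seed and reward table.
After the algorithm has stopped, the list does not change any more. -/
def history (A : Algorithm n d q) (s : A.Seed) (ω : ℕ → Fin n → Fin d → ℝ) :
    ℕ → List (Fin n × (Fin d → ℝ))
  | 0 => []
  | k + 1 =>
    match A.act s (A.history s ω k) with
    | Sum.inl a => A.history s ω k ++ [(a, ω k a)]
    | Sum.inr _ => A.history s ω k

/-- The algorithm stops and returns `out`. -/
def Returns (A : Algorithm n d q) (s : A.Seed) (ω : ℕ → Fin n → Fin d → ℝ)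
    (out : Fin q → Finset (Fin n)) : Prop :=
  ∃ k, A.act s (A.history s ω k) = Sum.inr out

/-- The total number of samples drawn; it is `∞` if the algorithm never stops. -/
noncomputable def samples (A : Algorithm n d q) (s : A.Seed)
    (ω : ℕ → Fin n → Fin d → ℝ) : ℝ≥0∞ :=
  ⨆ k, ((A.history s ω k).length : ℝ≥0∞)

/-- The joint law of the seed and the reward table (independent of each other). -/
noncomputable def runLaw (A : Algorithm n d q) (ν : Rewards n d) :
    Measure (A.Seed × (ℕ → Fin n → Fin d → ℝ)) :=
  (A.seedLaw : Measure A.Seed).prod ν.table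

/-- The expected number of samples drawn when the rewards are distributed according to `ν`. -/
noncomputable def expectedSamples (A : Algorithm n d q) (ν : Rewards n d) : ℝ≥0∞ :=
  ∫⁻ z, A.samples z.1 z.2 ∂(A.runLaw ν)

/-- The `(ε, δ)`-PAC guarantee on the instance `P`: whatever the unknown reward distributions
are, with probability at least `1 - δ` the algorithm stops and returns an `ε`-Pareto optimal
set of arms for every interval. -/
def IsPAC (A : Algorithm n d q) (P : Instance n q) (ε δ : ℝ) : Prop :=
  ∀ ν : Rewards n d,
    ENNReal.ofReal (1 - δ) ≤ A.runLaw ν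
      {z | ∃ out, A.Returns z.1 z.2 out ∧ ∀ i, P.IsParetoOptimal ν.weight ε i (out i)}

end Algorithm

end BanditRange

/-! Split the arms into M = τ k^d groups of m arms, one group for each cluster on the line and each
cell of the grid [k]^d. A configuration θ names the best arm of every group: by default a base arm
that leads by ε, otherwise one of the other m - 1 arms, raised by 2ε above its default mean. A cell
is 4ε below every later cell of its cluster in some coordinate, for an order extending the
componentwise one, and the intervals are the initial segments of that order. So a correct answer
spells out θ (`IsRight.mem_iff`), and M identification problems have to be solved at once.

Raising one arm moves one coin from bias 1/2 to 1/2 + 4ε, a divergence of order ε². Telling the two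
configurations apart therefore costs order ε⁻² log(1/x) draws of that arm, where x is the
probability, in the raised configuration, of the answer that is right for the other one. The factor
M inside the logarithm appears because x is of order δ/M on average: the answers obtained by
resetting one raised group are mutually exclusive and all wrong, so their probabilities sum to at
most δ (`sum_update_none_le`).

`prior_average` turns this into one inequality by means of a product prior. The default has weight
1/4 in each group: a constant, so that averaging over defaults loses only a constant factor in the
number of draws, and below 1/2, so that x = 4δ/(3M) stays away from 1/2 even for M = 2 and δ = 1/2.
The change of measure is the Donsker–Varadhan inequality on the decision tree cut off after K steps
(`treeExp_le_log`), in a linearised form that survives integration over the seed and the prior.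
Finally log(M/δ) is comparable with log(τ/(ε^d δ)) because ε = 1/(8k). -/

namespace BanditRange

/-! ### Two-point rewards and cylinders of reward tables -/

/-- Every reward law of `ν` puts mass `p a` on `X a true` and `1 - p a` on `X a false`. -/
structure Rewards.IsTwoPoint {n d : ℕ} (ν : Rewards n d) (p : Fin n → ℝ)
    (X : Fin n → Bool → Fin d → ℝ) : Prop where
  ne : ∀ a, X a true ≠ X a false
  nonneg : ∀ a, 0 ≤ p a
  le_one : ∀ a, p a ≤ 1
  law_eq : ∀ a, (ν.law a : Measure (Fin d → ℝ)) =
    ENNReal.ofReal (p a) • Measure.dirac (X a true) +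
      ENNReal.ofReal (1 - p a) • Measure.dirac (X a false)

namespace Rewards.IsTwoPoint

variable {n d : ℕ} {ν : Rewards n d} {p : Fin n → ℝ} {X : Fin n → Bool → Fin d → ℝ}

theorem law_true (h : ν.IsTwoPoint p X) (a : Fin n) :
    (ν.law a : Measure (Fin d → ℝ)) {X a true} = ENNReal.ofReal (p a) := by
  rw [h.law_eq]
  simp [(h.ne a).symm]

theorem law_false (h : ν.IsTwoPoint p X) (a : Fin n) :
    (ν.law a : Measure (Fin d → ℝ)) {X a false} = ENNReal.ofReal (1 - p a) := by
  rw [h.law_eq]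
  simp [h.ne a]

end Rewards.IsTwoPoint

section Cylinder

variable {n d : ℕ}

/-- The reward tables that agree with the list of observations `h`, entry by entry. -/
def cylinder (h : List (Fin n × (Fin d → ℝ))) : Set (ℕ → Fin n → Fin d → ℝ) :=
  Set.pi (Finset.range h.length) fun j => {row | ∀ y ∈ h[j]?, row y.1 = y.2}

theorem measurableSet_slot (o : Option (Fin n × (Fin d → ℝ))) :
    MeasurableSet {row : Fin n → Fin d → ℝ | ∀ y ∈ o, row y.1 = y.2} := by
  rcases o with _ | y
  · simp
  · simp only [Option.mem_def, Option.some.injEq, forall_eq']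
    exact measurableSet_eq_fun (measurable_pi_apply _) measurable_const

theorem measurableSet_cylinder (h : List (Fin n × (Fin d → ℝ))) :
    MeasurableSet (cylinder h) :=
  MeasurableSet.pi (Finset.countable_toSet _) fun _ _ => measurableSet_slot _

theorem mem_cylinder_append {h : List (Fin n × (Fin d → ℝ))} {y : Fin n × (Fin d → ℝ)}
    {ω : ℕ → Fin n → Fin d → ℝ} :
    ω ∈ cylinder (h ++ [y]) ↔ ω ∈ cylinder h ∧ ω h.length y.1 = y.2 := by
  simp only [cylinder, Set.mem_pi, Finset.coe_range, Set.mem_Iio, List.length_append,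
    List.length_singleton, Set.mem_ofPred_eq]
  constructor
  · intro H
    refine ⟨fun j hj => ?_, ?_⟩
    · have := H j (by omega)
      rwa [List.getElem?_append_left hj] at this
    · have := H h.length (by omega)
      simpa using this
  · rintro ⟨H1, H2⟩ j hj
    rcases Nat.lt_succ_iff_lt_or_eq.1 hj with hj | rfl
    · rw [List.getElem?_append_left hj]
      exact H1 j hj
    · simpa using H2

instance (ν : Rewards n d) : IsProbabilityMeasure ν.table := by
  unfold Rewards.table; infer_instance

theorem table_cylinder_append (ν : Rewards n d) (h : List (Fin n × (Fin d → ℝ)))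
    (a : Fin n) (x : Fin d → ℝ) :
    ν.table (cylinder (h ++ [(a, x)])) =
      ν.table (cylinder h) * (ν.law a : Measure (Fin d → ℝ)) {x} := by
  unfold Rewards.table cylinder
  rw [Measure.infinitePi_pi _ fun _ _ => measurableSet_slot _,
    Measure.infinitePi_pi _ fun _ _ => measurableSet_slot _]
  rw [List.length_append, List.length_singleton, Finset.prod_range_succ]
  congr 1
  · refine Finset.prod_congr rfl fun j hj => ?_
    rw [List.getElem?_append_left (Finset.mem_range.1 hj)]
  · have : {row : Fin n → Fin d → ℝ | ∀ y ∈ (h ++ [(a, x)])[h.length]?, row y.1 = y.2} =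
        Function.eval a ⁻¹' ({x} : Set (Fin d → ℝ)) := by
      ext row; simp
    rw [this, (measurePreserving_eval _ a).measure_preimage
      (measurableSet_singleton x).nullMeasurableSet]

end Cylinder

/-! ### Expectations as recursions on the decision tree -/

namespace Algorithm

variable {n d q : ℕ} (A : Algorithm n d q)

/-- One step of the recursion for expected values over the tree of two-point rewards. -/
def treeStep (p : Fin n → ℝ) (X : Fin n → Bool → Fin d → ℝ) (s : A.Seed)
    (f : List (Fin n × (Fin d → ℝ)) → ℝ) (h : List (Fin n × (Fin d → ℝ))) : ℝ :=
  Sum.elim (fun a => p a * f (h ++ [(a, X a true)]) + (1 - p a) * f (h ++ [(a, X a false)]))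
    (fun _ => f h) (A.act s h)

/-- The expected value of `f` at the history `K` steps after the history `h`, for the seed `s`,
when arm `a` shows `X a true` with probability `p a` and `X a false` otherwise. -/
def treeExp (p : Fin n → ℝ) (X : Fin n → Bool → Fin d → ℝ) (s : A.Seed) :
    ℕ → (List (Fin n × (Fin d → ℝ)) → ℝ) → List (Fin n × (Fin d → ℝ)) → ℝ
  | 0, f => f
  | K + 1, f => A.treeStep p X s (treeExp p X s K f)

theorem treeExp_succ_of_inl {p : Fin n → ℝ} {X : Fin n → Bool → Fin d → ℝ} {s : A.Seed}
    {h : List (Fin n × (Fin d → ℝ))} {a : Fin n} (hs : A.act s h = Sum.inl a) (K : ℕ)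
    (f : List (Fin n × (Fin d → ℝ)) → ℝ) :
    A.treeExp p X s (K + 1) f h = p a * A.treeExp p X s K f (h ++ [(a, X a true)]) +
      (1 - p a) * A.treeExp p X s K f (h ++ [(a, X a false)]) := by
  simp [treeExp, treeStep, hs]

theorem treeExp_of_inr {p : Fin n → ℝ} {X : Fin n → Bool → Fin d → ℝ} {s : A.Seed}
    {h : List (Fin n × (Fin d → ℝ))} {o : Fin q → Finset (Fin n)}
    (hs : A.act s h = Sum.inr o) (K : ℕ) (f : List (Fin n × (Fin d → ℝ)) → ℝ) :
    A.treeExp p X s K f h = f h := by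
  induction K with
  | zero => rfl
  | succ K ih => simp [treeExp, treeStep, hs, ih]

theorem treeExp_mono {p : Fin n → ℝ} (hp0 : ∀ a, 0 ≤ p a) (hp1 : ∀ a, p a ≤ 1)
    {X : Fin n → Bool → Fin d → ℝ} {s : A.Seed} (K : ℕ)
    {f g : List (Fin n × (Fin d → ℝ)) → ℝ} (hfg : ∀ h, f h ≤ g h)
    (h : List (Fin n × (Fin d → ℝ))) :
    A.treeExp p X s K f h ≤ A.treeExp p X s K g h := by
  induction K generalizing h with
  | zero => exact hfg h
  | succ K ih =>
    rcases hs : A.act s h with a | o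
    · rw [treeExp_succ_of_inl A hs, treeExp_succ_of_inl A hs]
      exact add_le_add (mul_le_mul_of_nonneg_left (ih _) (hp0 a))
        (mul_le_mul_of_nonneg_left (ih _) (sub_nonneg.2 (hp1 a)))
    · rw [treeExp_of_inr A hs, treeExp_of_inr A hs]
      exact hfg h

theorem treeExp_const {p : Fin n → ℝ} {X : Fin n → Bool → Fin d → ℝ} {s : A.Seed} (K : ℕ)
    (c : ℝ) (h : List (Fin n × (Fin d → ℝ))) :
    A.treeExp p X s K (fun _ => c) h = c := by
  induction K generalizing h with
  | zero => rfl
  | succ K ih =>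
    rcases hs : A.act s h with a | o
    · rw [treeExp_succ_of_inl A hs, ih, ih]; ring
    · rw [treeExp_of_inr A hs]

theorem treeExp_add {p : Fin n → ℝ} {X : Fin n → Bool → Fin d → ℝ} {s : A.Seed} (K : ℕ)
    (f g : List (Fin n × (Fin d → ℝ)) → ℝ) (h : List (Fin n × (Fin d → ℝ))) :
    A.treeExp p X s K (fun h => f h + g h) h =
      A.treeExp p X s K f h + A.treeExp p X s K g h := by
  induction K generalizing h with
  | zero => rfl
  | succ K ih =>
    rcases hs : A.act s h with a | o
    · simp only [treeExp_succ_of_inl A hs, ih]; ring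
    · simp only [treeExp_of_inr A hs]

theorem treeExp_const_mul {p : Fin n → ℝ} {X : Fin n → Bool → Fin d → ℝ} {s : A.Seed}
    (K : ℕ) (c : ℝ) (f : List (Fin n × (Fin d → ℝ)) → ℝ) (h : List (Fin n × (Fin d → ℝ))) :
    A.treeExp p X s K (fun h => c * f h) h = c * A.treeExp p X s K f h := by
  induction K generalizing h with
  | zero => rfl
  | succ K ih =>
    rcases hs : A.act s h with a | o
    · simp only [treeExp_succ_of_inl A hs, ih]; ring
    · simp only [treeExp_of_inr A hs]

theorem treeExp_sum {p : Fin n → ℝ} {X : Fin n → Bool → Fin d → ℝ} {s : A.Seed} (K : ℕ)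
    {ι : Type*} (t : Finset ι) (f : ι → List (Fin n × (Fin d → ℝ)) → ℝ)
    (h : List (Fin n × (Fin d → ℝ))) :
    A.treeExp p X s K (fun h => ∑ i ∈ t, f i h) h = ∑ i ∈ t, A.treeExp p X s K (f i) h := by
  classical
  induction t using Finset.induction_on with
  | empty => simpa using A.treeExp_const K 0 h
  | insert i t hi ih => simp only [Finset.sum_insert hi, treeExp_add, ih]

theorem treeExp_nonneg {p : Fin n → ℝ} (hp0 : ∀ a, 0 ≤ p a) (hp1 : ∀ a, p a ≤ 1)
    {X : Fin n → Bool → Fin d → ℝ} {s : A.Seed} (K : ℕ)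
    {f : List (Fin n × (Fin d → ℝ)) → ℝ} (hf : ∀ h, 0 ≤ f h)
    (h : List (Fin n × (Fin d → ℝ))) : 0 ≤ A.treeExp p X s K f h := by
  simpa [treeExp_const] using A.treeExp_mono hp0 hp1 (s := s) (X := X) K hf h

theorem measurableSet_act (h : List (Fin n × (Fin d → ℝ)))
    (y : Fin n ⊕ (Fin q → Finset (Fin n))) : MeasurableSet {s | A.act s h = y} := by
  have := (A.measurable_act h.length y).preimage
    (measurable_prodMk_right (y := h.get) : Measurable fun s : A.Seed => (s, h.get))
  simpa [Set.preimage] using this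

theorem measurable_act_comp {β : Type*} [MeasurableSpace β] (h : List (Fin n × (Fin d → ℝ)))
    {g : Fin n ⊕ (Fin q → Finset (Fin n)) → A.Seed → β} (hg : ∀ y, Measurable (g y)) :
    Measurable fun s => g (A.act s h) s := by
  intro t ht
  have : (fun s => g (A.act s h) s) ⁻¹' t = ⋃ y, {s | A.act s h = y} ∩ g y ⁻¹' t := by
    ext s; simp
  rw [this]
  exact MeasurableSet.iUnion fun y => (A.measurableSet_act h y).inter (hg y ht)

theorem measurable_treeExp (p : Fin n → ℝ) (X : Fin n → Bool → Fin d → ℝ) (K : ℕ)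
    {F : A.Seed → List (Fin n × (Fin d → ℝ)) → ℝ} (hF : ∀ h, Measurable fun s => F s h)
    (h : List (Fin n × (Fin d → ℝ))) : Measurable fun s => A.treeExp p X s K (F s) h := by
  induction K generalizing h with
  | zero => exact hF h
  | succ K ih =>
    refine A.measurable_act_comp h (g := fun y s => Sum.elim
      (fun a => p a * A.treeExp p X s K (F s) (h ++ [(a, X a true)]) +
        (1 - p a) * A.treeExp p X s K (F s) (h ++ [(a, X a false)]))
      (fun _ => A.treeExp p X s K (F s) h) y) ?_
    rintro (a | o)
    · exact ((ih _).const_mul _).add ((ih _).const_mul _)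
    · exact ih _

theorem history_of_inr {s : A.Seed} {ω : ℕ → Fin n → Fin d → ℝ}
    {h : List (Fin n × (Fin d → ℝ))} {k : ℕ} {o : Fin q → Finset (Fin n)}
    (hh : A.history s ω k = h) (hs : A.act s h = Sum.inr o) (K : ℕ) :
    A.history s ω (k + K) = h := by
  induction K with
  | zero => exact hh
  | succ K ih => rw [← add_assoc, history, ih, hs]

theorem setLIntegral_prod_fst {α β : Type*} [MeasurableSpace α] [MeasurableSpace β]
    (μ : Measure α) (ν : Measure β) [SFinite μ] [SFinite ν] {f : α → ℝ≥0∞}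
    (hf : Measurable f) (s : Set α) (t : Set β) :
    ∫⁻ z in s ×ˢ t, f z.1 ∂(μ.prod ν) = (∫⁻ x in s, f x ∂μ) * ν t := by
  rw [← Measure.prod_restrict]
  have := lintegral_prod_mul (μ := μ.restrict s) (ν := ν.restrict t) (f := f)
    (g := fun _ => 1) hf.aemeasurable aemeasurable_const
  simpa using this

variable {ν : Rewards n d} {p : Fin n → ℝ} {X : Fin n → Bool → Fin d → ℝ}

/-- Induction on the remaining steps: on the cylinder of `h` the next draw reads a fresh row, so its
two values split the cylinder with weights `p a` and `1 - p a`. The seed set `B` is kept general so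
that it can be cut according to the next action. The integrand is never required to be measurable in
the table. -/
theorem setLIntegral_history (hν : ν.IsTwoPoint p X)
    {F : A.Seed → List (Fin n × (Fin d → ℝ)) → ℝ} (hF0 : ∀ s h, 0 ≤ F s h)
    (hF : ∀ h, Measurable fun s => F s h) (K : ℕ) (h : List (Fin n × (Fin d → ℝ)))
    {B : Set A.Seed} (hB : MeasurableSet B)
    (hh : ∀ s ∈ B, ∀ ω ∈ cylinder h, A.history s ω h.length = h) :
    ∫⁻ z in B ×ˢ cylinder h, ENNReal.ofReal (F z.1 (A.history z.1 z.2 (h.length + K)))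
        ∂(A.runLaw ν) =
      (∫⁻ s in B, ENNReal.ofReal (A.treeExp p X s K (F s) h) ∂(A.seedLaw : Measure A.Seed)) *
        ν.table (cylinder h) := by
  induction K generalizing h B with
  | zero =>
    rw [← setLIntegral_prod_fst _ _ (A.measurable_treeExp p X 0 hF h).ennreal_ofReal]
    refine setLIntegral_congr_fun (hB.prod (measurableSet_cylinder h)) fun z hz => ?_
    simp only [add_zero, treeExp]
    rw [hh z.1 hz.1 z.2 hz.2]
  | succ K ih =>
    -- On seeds that all take the same action at `h`, the recursion is a single explicit step; there
    -- are only countably many actions to sum over.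
    have key : ∀ y, ∀ B' : Set A.Seed, MeasurableSet B' → B' ⊆ B →
        (∀ s ∈ B', A.act s h = y) →
        ∫⁻ z in B' ×ˢ cylinder h,
            ENNReal.ofReal (F z.1 (A.history z.1 z.2 (h.length + (K + 1)))) ∂(A.runLaw ν) =
          (∫⁻ s in B', ENNReal.ofReal (A.treeExp p X s (K + 1) (F s) h)
            ∂(A.seedLaw : Measure A.Seed)) * ν.table (cylinder h) := by
      intro y B' hB' hsub hy
      rcases y with a | o
      · have hnext : ∀ b, ∀ s ∈ B', ∀ ω ∈ cylinder (h ++ [(a, X a b)]),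
            A.history s ω (h ++ [(a, X a b)]).length = h ++ [(a, X a b)] := by
          intro b s hs ω hω
          rw [mem_cylinder_append] at hω
          rw [List.length_append, List.length_singleton, history, hh s (hsub hs) ω hω.1, hy s hs]
          simp only [hω.2]
        have h1 := ih (h ++ [(a, X a true)]) hB' (hnext true)
        have h0 := ih (h ++ [(a, X a false)]) hB' (hnext false)
        simp only [List.length_append, List.length_singleton, add_assoc, add_comm 1 K] at h1 h0
        have hdisj : Disjoint (cylinder (h ++ [(a, X a true)]))
            (cylinder (h ++ [(a, X a false)])) := by
          refine Set.disjoint_left.2 fun ω w1 w0 => hν.ne a ?_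
          rw [mem_cylinder_append] at w1 w0
          exact w1.2.symm.trans w0.2
        -- Tables showing neither of the two values at this draw form a null set.
        have hunion : (cylinder (h ++ [(a, X a true)]) ∪ cylinder (h ++ [(a, X a false)]) :
            Set (ℕ → Fin n → Fin d → ℝ)) =ᵐ[ν.table] cylinder h := by
          refine ae_eq_of_subset_of_measure_ge ?_ ?_
            ((measurableSet_cylinder _).union (measurableSet_cylinder _)).nullMeasurableSet
            (measure_ne_top _ _)
          · rintro ω (w | w) <;> exact (mem_cylinder_append.1 w).1
          · rw [measure_union hdisj (measurableSet_cylinder _), table_cylinder_append,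
              table_cylinder_append, hν.law_true, hν.law_false, ← mul_add,
              ← ENNReal.ofReal_add (hν.nonneg a) (sub_nonneg.2 (hν.le_one a))]
            simp
        have hprod : (B' ×ˢ cylinder h : Set (A.Seed × (ℕ → Fin n → Fin d → ℝ)))
            =ᵐ[A.runLaw ν] (B' ×ˢ cylinder (h ++ [(a, X a true)]) ∪
              B' ×ˢ cylinder (h ++ [(a, X a false)]) :
                Set (A.Seed × (ℕ → Fin n → Fin d → ℝ))) := by
          rw [← Set.prod_union]
          exact Measure.set_prod_ae_eq (ae_eq_refl _) hunion.symm
        rw [setLIntegral_congr hprod, lintegral_union (hB'.prod (measurableSet_cylinder _))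
          (Set.disjoint_prod.2 (Or.inr hdisj)), h1, h0, table_cylinder_append,
          table_cylinder_append, hν.law_true, hν.law_false]
        have hexp : ∫⁻ s in B', ENNReal.ofReal (A.treeExp p X s (K + 1) (F s) h)
              ∂(A.seedLaw : Measure A.Seed) =
            ∫⁻ s in B', (ENNReal.ofReal (p a) *
                ENNReal.ofReal (A.treeExp p X s K (F s) (h ++ [(a, X a true)])) +
              ENNReal.ofReal (1 - p a) *
                ENNReal.ofReal (A.treeExp p X s K (F s) (h ++ [(a, X a false)])))
              ∂(A.seedLaw : Measure A.Seed) := by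
          refine setLIntegral_congr_fun hB' fun s hs => ?_
          have e1 := A.treeExp_nonneg hν.nonneg hν.le_one (X := X) (s := s) K (hF0 s)
            (h ++ [(a, X a true)])
          have e0 := A.treeExp_nonneg hν.nonneg hν.le_one (X := X) (s := s) K (hF0 s)
            (h ++ [(a, X a false)])
          have q1 := sub_nonneg.2 (hν.le_one a)
          rw [treeExp_succ_of_inl A (hy s hs),
            ENNReal.ofReal_add (mul_nonneg (hν.nonneg a) e1) (mul_nonneg q1 e0),
            ENNReal.ofReal_mul (hν.nonneg a), ENNReal.ofReal_mul q1]
        rw [hexp, lintegral_add_left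
          ((A.measurable_treeExp p X K hF _).ennreal_ofReal.const_mul _),
          lintegral_const_mul _ (A.measurable_treeExp p X K hF _).ennreal_ofReal,
          lintegral_const_mul _ (A.measurable_treeExp p X K hF _).ennreal_ofReal]
        ring
      · rw [← setLIntegral_prod_fst _ _ (A.measurable_treeExp p X (K + 1) hF h).ennreal_ofReal]
        refine setLIntegral_congr_fun (hB'.prod (measurableSet_cylinder h)) fun z hz => ?_
        rw [treeExp_of_inr A (hy _ hz.1),
          A.history_of_inr (hh z.1 (hsub hz.1) z.2 hz.2) (hy _ hz.1)]
    have hBU : B = ⋃ y, B ∩ {s | A.act s h = y} := by ext s; simp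
    have hm : ∀ y, MeasurableSet (B ∩ {s | A.act s h = y}) :=
      fun y => hB.inter (A.measurableSet_act h y)
    have hd : Pairwise (Function.onFun Disjoint fun y => B ∩ {s | A.act s h = y}) := by
      intro y y' hyy
      exact Set.disjoint_left.2 fun s hs hs' => hyy (hs.2.symm.trans hs'.2)
    rw [hBU, Set.iUnion_prod_const, lintegral_iUnion
      (fun y => (hm y).prod (measurableSet_cylinder h)), lintegral_iUnion hm hd,
      ← ENNReal.tsum_mul_right]
    · exact tsum_congr fun y => key y _ (hm y) Set.inter_subset_left fun s hs => hs.2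
    · intro y y' hyy
      exact Set.disjoint_prod.2 (Or.inl (hd hyy))

/-- Expected values of functions of the seed and the history after `K` steps. -/
theorem lintegral_history (hν : ν.IsTwoPoint p X)
    {F : A.Seed → List (Fin n × (Fin d → ℝ)) → ℝ} (hF0 : ∀ s h, 0 ≤ F s h)
    (hF : ∀ h, Measurable fun s => F s h) (K : ℕ) :
    ∫⁻ z, ENNReal.ofReal (F z.1 (A.history z.1 z.2 K)) ∂(A.runLaw ν) =
      ∫⁻ s, ENNReal.ofReal (A.treeExp p X s K (F s) []) ∂(A.seedLaw : Measure A.Seed) := by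
  have hc : cylinder ([] : List (Fin n × (Fin d → ℝ))) = Set.univ := by
    simp [cylinder]
  have := A.setLIntegral_history hν hF0 hF K [] MeasurableSet.univ (fun _ _ _ _ => rfl)
  simpa [hc] using this

end Algorithm

/-- For arbitrary `S` the first term is an outer measure and the second a lower integral. A
measurable minorant with the same integral is supported on a measurable subset of the complement of
`S`, and additivity applies to that subset. -/
theorem measure_add_lintegral_indicator_compl_le {α : Type*} [MeasurableSpace α]
    (μ : Measure α) (S : Set α) :
    μ S + ∫⁻ x, Sᶜ.indicator 1 x ∂μ ≤ μ Set.univ := by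
  obtain ⟨f, hf, hle, heq⟩ := exists_measurable_le_lintegral_eq μ (Sᶜ.indicator (1 : α → ℝ≥0∞))
  have hT : MeasurableSet {x | f x ≠ 0} := hf (measurableSet_singleton 0).compl
  have h1 : ∫⁻ x, f x ∂μ ≤ μ {x | f x ≠ 0} := by
    rw [← lintegral_indicator_one hT]
    refine lintegral_mono fun x => ?_
    by_cases hx : f x = 0
    · simp [hx]
    · rw [Set.indicator_of_mem (by exact hx)]
      exact (hle x).trans (Set.indicator_le_self' (fun _ _ => zero_le_one) x)
  have h2 : μ S ≤ μ {x | f x ≠ 0}ᶜ := by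
    refine measure_mono fun x hx => ?_
    have := hle x
    simp only [Set.indicator_of_notMem (fun h : x ∈ Sᶜ => h hx)] at this
    simpa using this
  rw [heq, ← measure_add_measure_compl hT, add_comm]
  exact add_le_add h1 h2

/-! ### Change of measure between two reward models -/

namespace Algorithm

variable {n d q : ℕ} (A : Algorithm n d q)

theorem treeExp_pos {p : Fin n → ℝ} (hp0 : ∀ a, 0 ≤ p a) (hp1 : ∀ a, p a ≤ 1)
    {X : Fin n → Bool → Fin d → ℝ} {s : A.Seed} (K : ℕ)
    {f : List (Fin n × (Fin d → ℝ)) → ℝ} (hf : ∀ h, 0 < f h)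
    (h : List (Fin n × (Fin d → ℝ))) : 0 < A.treeExp p X s K f h := by
  induction K generalizing h with
  | zero => exact hf h
  | succ K ih =>
    rcases hs : A.act s h with a | o
    · rw [treeExp_succ_of_inl A hs]
      have h1 := ih (h ++ [(a, X a true)])
      have h0 := ih (h ++ [(a, X a false)])
      rcases (hp0 a).eq_or_lt with hp | hp
      · simpa [← hp] using h0
      · exact add_pos_of_pos_of_nonneg (mul_pos hp h1) (mul_nonneg (sub_nonneg.2 (hp1 a)) h0.le)
    · rw [treeExp_of_inr A hs]
      exact hf h

/-- The number of draws from the arm `a` in a history. -/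
def draws (a : Fin n) (h : List (Fin n × (Fin d → ℝ))) : ℝ :=
  ((h.map Prod.fst).count a : ℝ)

theorem draws_nonneg (a : Fin n) (h : List (Fin n × (Fin d → ℝ))) : 0 ≤ draws a h :=
  Nat.cast_nonneg _

theorem draws_append (a b : Fin n) (x : Fin d → ℝ) (h : List (Fin n × (Fin d → ℝ))) :
    draws a (h ++ [(b, x)]) = draws a h + if b = a then 1 else 0 := by
  unfold draws
  rw [List.map_append, List.count_append]
  by_cases hb : b = a <;> simp [hb]

theorem sum_draws (h : List (Fin n × (Fin d → ℝ))) : ∑ a, draws a h = (h.length : ℝ) := by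
  induction h using List.reverseRecOn with
  | nil => simp [draws]
  | append_singleton h y ih =>
    obtain ⟨b, x⟩ := y
    simp only [draws_append, Finset.sum_add_distrib, ih]
    simp

theorem draws_le_length (a : Fin n) (h : List (Fin n × (Fin d → ℝ))) :
    draws a h ≤ (h.length : ℝ) := by
  rw [← sum_draws]
  exact Finset.single_le_sum (f := fun b => draws b h) (fun b _ => draws_nonneg b h)
    (Finset.mem_univ a)

theorem treeExp_length_le {p : Fin n → ℝ} (hp0 : ∀ a, 0 ≤ p a) (hp1 : ∀ a, p a ≤ 1)
    {X : Fin n → Bool → Fin d → ℝ} {s : A.Seed} (K : ℕ) (h : List (Fin n × (Fin d → ℝ))) :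
    A.treeExp p X s K (fun h => (h.length : ℝ)) h ≤ h.length + K := by
  induction K generalizing h with
  | zero => simp [treeExp]
  | succ K ih =>
    rcases hs : A.act s h with a | o
    · rw [treeExp_succ_of_inl A hs]
      have h1 := mul_le_mul_of_nonneg_left (ih (h ++ [(a, X a true)])) (hp0 a)
      have h0 := mul_le_mul_of_nonneg_left (ih (h ++ [(a, X a false)])) (sub_nonneg.2 (hp1 a))
      simp only [List.length_append, List.length_singleton] at h1 h0
      push_cast at h1 h0 ⊢
      linarith
    · rw [treeExp_of_inr A hs]
      push_cast
      linarith [(Nat.cast_nonneg K : (0 : ℝ) ≤ K)]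

/-- A variational form of the data-processing inequality for two reward models: `κ` bounds the
divergence of the rewards of the arm `a`, and the other arms have the same rewards. -/
theorem treeExp_le_log {p p' : Fin n → ℝ} (hp0 : ∀ a, 0 ≤ p a) (hp1 : ∀ a, p a ≤ 1)
    (hp0' : ∀ a, 0 ≤ p' a) (hp1' : ∀ a, p' a ≤ 1) {a : Fin n} {κ : ℝ}
    (hκ : ∀ b y z, 0 < y → 0 < z → p b * Real.log y + (1 - p b) * Real.log z ≤
      (if b = a then κ else 0) + Real.log (p' b * y + (1 - p' b) * z))
    {X : Fin n → Bool → Fin d → ℝ} {s : A.Seed} (K : ℕ)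
    (Z : List (Fin n × (Fin d → ℝ)) → ℝ) (h : List (Fin n × (Fin d → ℝ))) :
    A.treeExp p X s K Z h ≤ κ * (A.treeExp p X s K (draws a) h - draws a h) +
      Real.log (A.treeExp p' X s K (fun h => Real.exp (Z h)) h) := by
  induction K generalizing h with
  | zero => simp [treeExp]
  | succ K ih =>
    rcases hs : A.act s h with b | o
    · simp only [treeExp_succ_of_inl A hs]
      have h1 := mul_le_mul_of_nonneg_left (ih (h ++ [(b, X b true)])) (hp0 b)
      have h0 := mul_le_mul_of_nonneg_left (ih (h ++ [(b, X b false)])) (sub_nonneg.2 (hp1 b))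
      rw [draws_append] at h1 h0
      -- Chain rule: the one-draw inequality at the exponential moments of the two children passes
      -- the logarithm up one level, and charges κ only for a draw from `a`.
      have h2 := hκ b _ _
        (A.treeExp_pos hp0' hp1' K (X := X) (s := s) (fun h => Real.exp_pos (Z h))
          (h ++ [(b, X b true)]))
        (A.treeExp_pos hp0' hp1' K (X := X) (s := s) (fun h => Real.exp_pos (Z h))
          (h ++ [(b, X b false)]))
      have h3 : (if b = a then κ else 0) = κ * (if b = a then (1 : ℝ) else 0) := by
        split_ifs <;> simp
      rw [h3] at h2
      linarith
    · simp [treeExp_of_inr A hs]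

/-- The variational inequality for a test function taking the two values u and v, followed by log x
≤ x - 1. The result is affine in both probabilities, hence can be averaged; suitable u and v make
the second step lossless after averaging. -/
theorem treeExp_binary_le {p p' : Fin n → ℝ} (hp0 : ∀ a, 0 ≤ p a) (hp1 : ∀ a, p a ≤ 1)
    (hp0' : ∀ a, 0 ≤ p' a) (hp1' : ∀ a, p' a ≤ 1) {a : Fin n} {κ : ℝ}
    (hκ : ∀ b y z, 0 < y → 0 < z → p b * Real.log y + (1 - p b) * Real.log z ≤
      (if b = a then κ else 0) + Real.log (p' b * y + (1 - p' b) * z))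
    {X : Fin n → Bool → Fin d → ℝ} {s : A.Seed} (K : ℕ)
    {f : List (Fin n × (Fin d → ℝ)) → ℝ} (hf : ∀ h, f h = 0 ∨ f h = 1) (u v : ℝ) :
    u + (v - u) * A.treeExp p X s K f [] ≤ κ * A.treeExp p X s K (draws a) [] +
      (Real.exp u + (Real.exp v - Real.exp u) * A.treeExp p' X s K f [] - 1) := by
  have h1 := A.treeExp_le_log hp0 hp1 hp0' hp1' hκ (X := X) (s := s) K
    (fun h => u + (v - u) * f h) []
  have h2 : (fun h => Real.exp (u + (v - u) * f h)) =
      fun h => Real.exp u + (Real.exp v - Real.exp u) * f h := by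
    funext h
    rcases hf h with h0 | h0 <;> simp [h0]
  have h3 := Real.log_le_sub_one_of_pos (A.treeExp_pos hp0' hp1' (X := X) (s := s) K
    (fun h => Real.exp_pos (u + (v - u) * f h)) [])
  rw [h2] at h1 h3
  simp only [treeExp_add, treeExp_const, treeExp_const_mul] at h1 h3
  have h4 : draws a ([] : List (Fin n × (Fin d → ℝ))) = 0 := by simp [draws]
  rw [h4, sub_zero] at h1
  linarith

/-! ### Halting events and expectations over the seed -/

open Classical in
/-- The indicator of the event that the algorithm stops at the history `h` with an output that
satisfies `R`. -/
noncomputable def haltInd (R : (Fin q → Finset (Fin n)) → Prop) (s : A.Seed)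
    (h : List (Fin n × (Fin d → ℝ))) : ℝ :=
  if ∃ out, A.act s h = Sum.inr out ∧ R out then 1 else 0

theorem haltInd_eq (R : (Fin q → Finset (Fin n)) → Prop) (s : A.Seed)
    (h : List (Fin n × (Fin d → ℝ))) : A.haltInd R s h = 0 ∨ A.haltInd R s h = 1 := by
  unfold haltInd; split_ifs <;> simp

theorem haltInd_nonneg (R : (Fin q → Finset (Fin n)) → Prop) (s : A.Seed)
    (h : List (Fin n × (Fin d → ℝ))) : 0 ≤ A.haltInd R s h := by
  rcases A.haltInd_eq R s h with h | h <;> simp [h]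

theorem haltInd_le_one (R : (Fin q → Finset (Fin n)) → Prop) (s : A.Seed)
    (h : List (Fin n × (Fin d → ℝ))) : A.haltInd R s h ≤ 1 := by
  rcases A.haltInd_eq R s h with h | h <;> simp [h]

theorem measurable_haltInd (R : (Fin q → Finset (Fin n)) → Prop)
    (h : List (Fin n × (Fin d → ℝ))) : Measurable fun s => A.haltInd R s h := by
  classical
  exact A.measurable_act_comp h
    (g := fun y _ => if ∃ out, y = Sum.inr out ∧ R out then (1 : ℝ) else 0)
    fun _ => measurable_const

theorem sum_haltInd_le {ι : Type*} (t : Finset ι) {R : ι → (Fin q → Finset (Fin n)) → Prop}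
    (hR : ∀ i j out, R i out → R j out → i = j) (s : A.Seed)
    (h : List (Fin n × (Fin d → ℝ))) : ∑ i ∈ t, A.haltInd (R i) s h ≤ 1 := by
  classical
  by_cases H : ∃ i ∈ t, A.haltInd (R i) s h ≠ 0
  · obtain ⟨i, hi, hne⟩ := H
    rw [Finset.sum_eq_single_of_mem i hi]
    · exact A.haltInd_le_one _ _ _
    · intro j _ hj
      by_contra hne'
      simp only [haltInd, ne_eq, ite_eq_right_iff, one_ne_zero, imp_false, not_not] at hne hne'
      obtain ⟨o, ho, h1⟩ := hne
      obtain ⟨o', ho', h1'⟩ := hne'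
      rw [ho, Sum.inr.injEq] at ho'
      subst ho'
      exact hj (hR _ _ _ h1' h1)
  · push Not at H
    rw [Finset.sum_eq_zero H]
    exact zero_le_one

/-- The expected value, over seed and rewards, of a function of the seed and the history after
`K` steps. -/
noncomputable def runExp (p : Fin n → ℝ) (X : Fin n → Bool → Fin d → ℝ) (K : ℕ)
    (F : A.Seed → List (Fin n × (Fin d → ℝ)) → ℝ) : ℝ :=
  ∫ s, A.treeExp p X s K (F s) [] ∂(A.seedLaw : Measure A.Seed)

section RunExp

variable {p : Fin n → ℝ} (hp0 : ∀ a, 0 ≤ p a) (hp1 : ∀ a, p a ≤ 1)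
  {X : Fin n → Bool → Fin d → ℝ}

include hp0 hp1

theorem integrable_treeExp_haltInd (R : (Fin q → Finset (Fin n)) → Prop) (K : ℕ) :
    Integrable (fun s => A.treeExp p X s K (A.haltInd R s) [])
      (A.seedLaw : Measure A.Seed) := by
  refine Integrable.of_bound
    (A.measurable_treeExp p X K (A.measurable_haltInd R) []).aestronglyMeasurable 1
    (Filter.Eventually.of_forall fun s => ?_)
  rw [Real.norm_of_nonneg (A.treeExp_nonneg hp0 hp1 K (A.haltInd_nonneg R s) [])]
  simpa [treeExp_const] using
    A.treeExp_mono hp0 hp1 (X := X) (s := s) K (A.haltInd_le_one R s) []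

theorem integrable_treeExp_draws (a : Fin n) (K : ℕ) :
    Integrable (fun s => A.treeExp p X s K (draws a) []) (A.seedLaw : Measure A.Seed) := by
  refine Integrable.of_bound (A.measurable_treeExp p X K
    (F := fun _ => draws a) (fun _ => measurable_const) []).aestronglyMeasurable K
    (Filter.Eventually.of_forall fun s => ?_)
  rw [Real.norm_of_nonneg (A.treeExp_nonneg hp0 hp1 K (draws_nonneg a) [])]
  refine (A.treeExp_mono hp0 hp1 (X := X) (s := s) K (draws_le_length a) []).trans ?_
  simpa using A.treeExp_length_le hp0 hp1 (X := X) (s := s) K []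

theorem runExp_haltInd_nonneg (R : (Fin q → Finset (Fin n)) → Prop) (K : ℕ) :
    0 ≤ A.runExp p X K (A.haltInd R) :=
  integral_nonneg fun s => A.treeExp_nonneg hp0 hp1 K (A.haltInd_nonneg R s) []

theorem runExp_draws_nonneg (a : Fin n) (K : ℕ) :
    0 ≤ A.runExp p X K fun _ => draws a :=
  integral_nonneg fun _ => A.treeExp_nonneg hp0 hp1 K (draws_nonneg a) []

theorem sum_runExp_haltInd_le {ι : Type*} (t : Finset ι)
    {R : ι → (Fin q → Finset (Fin n)) → Prop}
    (hR : ∀ i j out, R i out → R j out → i = j) (K : ℕ) :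
    ∑ i ∈ t, A.runExp p X K (A.haltInd (R i)) ≤ 1 := by
  unfold runExp
  rw [← integral_finsetSum _ fun i _ => A.integrable_treeExp_haltInd hp0 hp1 (R i) K]
  have : ∫ _ : A.Seed, (1 : ℝ) ∂(A.seedLaw : Measure A.Seed) = 1 := by simp
  rw [← this]
  refine integral_mono
    (integrable_finsetSum _ fun i _ => A.integrable_treeExp_haltInd hp0 hp1 (R i) K)
    (integrable_const _) fun s => ?_
  simp only
  rw [← treeExp_sum]
  simpa [treeExp_const] using
    A.treeExp_mono hp0 hp1 (X := X) (s := s) K (A.sum_haltInd_le t hR s) []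

theorem runExp_binary_le {p' : Fin n → ℝ} (hp0' : ∀ a, 0 ≤ p' a) (hp1' : ∀ a, p' a ≤ 1)
    {a : Fin n} {κ : ℝ}
    (hκ : ∀ b y z, 0 < y → 0 < z → p b * Real.log y + (1 - p b) * Real.log z ≤
      (if b = a then κ else 0) + Real.log (p' b * y + (1 - p' b) * z)) (K : ℕ)
    (R : (Fin q → Finset (Fin n)) → Prop) (u v : ℝ) :
    u + (v - u) * A.runExp p X K (A.haltInd R) ≤ κ * A.runExp p X K (fun _ => draws a) +
      (Real.exp u + (Real.exp v - Real.exp u) * A.runExp p' X K (A.haltInd R) - 1) := by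
  have i1 := A.integrable_treeExp_haltInd hp0 hp1 (X := X) R K
  have i2 := A.integrable_treeExp_haltInd hp0' hp1' (X := X) R K
  have i3 := A.integrable_treeExp_draws hp0 hp1 (X := X) a K
  have j1 : Integrable (fun s => Real.exp u + (Real.exp v - Real.exp u) *
      A.treeExp p' X s K (A.haltInd R s) []) (A.seedLaw : Measure A.Seed) :=
    (integrable_const _).add (i2.const_mul _)
  have j2 : Integrable (fun s => Real.exp u + (Real.exp v - Real.exp u) *
      A.treeExp p' X s K (A.haltInd R s) [] - 1) (A.seedLaw : Measure A.Seed) :=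
    j1.sub (integrable_const _)
  have := integral_mono (μ := (A.seedLaw : Measure A.Seed))
    (f := fun s => u + (v - u) * A.treeExp p X s K (A.haltInd R s) [])
    (g := fun s => κ * A.treeExp p X s K (draws a) [] +
      (Real.exp u + (Real.exp v - Real.exp u) * A.treeExp p' X s K (A.haltInd R s) [] - 1))
    ((integrable_const _).add (i1.const_mul _))
    ((i3.const_mul _).add j2)
    fun s => A.treeExp_binary_le hp0 hp1 hp0' hp1' hκ K (A.haltInd_eq R s) u v
  rw [integral_add (integrable_const _) (i1.const_mul _),
    integral_add (i3.const_mul _) j2, integral_sub j1 (integrable_const _),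
    integral_add (integrable_const _) (i2.const_mul _)] at this
  simpa [integral_const_mul, runExp] using this

end RunExp

variable {ν : Rewards n d} {p : Fin n → ℝ} {X : Fin n → Bool → Fin d → ℝ}

/-- `lintegral_history` evaluates the lower integral of the complementary indicator, which bounds
the outer measure of the event without a proof that it is measurable. -/
theorem measure_halts_le (hν : ν.IsTwoPoint p X) (R : (Fin q → Finset (Fin n)) → Prop)
    (K : ℕ) :
    A.runLaw ν {z | ∃ out, A.act z.1 (A.history z.1 z.2 K) = Sum.inr out ∧ R out} ≤
      ENNReal.ofReal (A.runExp p X K (A.haltInd R)) := by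
  have : IsProbabilityMeasure (A.runLaw ν) := by unfold runLaw; infer_instance
  set S := {z : A.Seed × (ℕ → Fin n → Fin d → ℝ) |
    ∃ out, A.act z.1 (A.history z.1 z.2 K) = Sum.inr out ∧ R out}
  have h1 := measure_add_lintegral_indicator_compl_le (A.runLaw ν) S
  have h2 : ∀ z, Sᶜ.indicator (1 : A.Seed × (ℕ → Fin n → Fin d → ℝ) → ℝ≥0∞) z =
      ENNReal.ofReal (1 - A.haltInd R z.1 (A.history z.1 z.2 K)) := by
    intro z
    by_cases hz : z ∈ S
    · rw [Set.indicator_of_notMem (fun h : z ∈ Sᶜ => h hz), haltInd,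
        if_pos (show ∃ out, _ from hz)]
      simp
    · rw [Set.indicator_of_mem (by exact hz), haltInd,
        if_neg (show ¬∃ out, _ from hz)]
      simp
  have i1 := A.integrable_treeExp_haltInd hν.nonneg hν.le_one (X := X) R K
  rw [lintegral_congr h2, A.lintegral_history hν
    (F := fun s h => 1 - A.haltInd R s h) (fun s h => sub_nonneg.2 (A.haltInd_le_one R s h))
    (fun h => measurable_const.sub (A.measurable_haltInd R h)) K, measure_univ] at h1
  have h3 : ∀ s, A.treeExp p X s K (fun h => 1 - A.haltInd R s h) [] =
      1 - A.treeExp p X s K (A.haltInd R s) [] := by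
    intro s
    have := A.treeExp_add (p := p) (X := X) (s := s) K (fun h => 1 - A.haltInd R s h)
      (A.haltInd R s) []
    simp only [sub_add_cancel, treeExp_const] at this
    linarith
  have h4 : ∀ s, A.treeExp p X s K (A.haltInd R s) [] ≤ 1 := fun s => by
    simpa [treeExp_const] using
      A.treeExp_mono hν.nonneg hν.le_one (X := X) (s := s) K (A.haltInd_le_one R s) []
  have i2 : Integrable (fun s => 1 - A.treeExp p X s K (A.haltInd R s) [])
      (A.seedLaw : Measure A.Seed) := (integrable_const _).sub i1
  simp_rw [h3] at h1
  rw [← ofReal_integral_eq_lintegral_ofReal i2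
    (Filter.Eventually.of_forall fun s => sub_nonneg.2 (h4 s)),
    integral_sub (integrable_const _) i1] at h1
  simp only [integral_const, probReal_univ, smul_eq_mul, mul_one] at h1
  have h5 : A.runExp p X K (A.haltInd R) ≤ 1 := by
    simpa using A.sum_runExp_haltInd_le hν.nonneg hν.le_one (X := X) {()} (R := fun _ => R)
      (fun _ _ _ _ _ => rfl) K
  change _ + ENNReal.ofReal (1 - A.runExp p X K (A.haltInd R)) ≤ 1 at h1
  have h6 : (1 : ℝ≥0∞) = ENNReal.ofReal (A.runExp p X K (A.haltInd R)) +
      ENNReal.ofReal (1 - A.runExp p X K (A.haltInd R)) := by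
    rw [← ENNReal.ofReal_add (A.runExp_haltInd_nonneg hν.nonneg hν.le_one R K)
      (sub_nonneg.2 h5)]
    simp
  rw [h6] at h1
  exact (ENNReal.add_le_add_iff_right ENNReal.ofReal_ne_top).1 h1

theorem sum_runExp_draws_le (hν : ν.IsTwoPoint p X) (K : ℕ) {S : ℝ} (hS0 : 0 ≤ S)
    (hS : A.expectedSamples ν ≤ ENNReal.ofReal S) :
    ∑ a, A.runExp p X K (fun _ => draws a) ≤ S := by
  have i := fun a => A.integrable_treeExp_draws hν.nonneg hν.le_one (X := X) a K
  unfold runExp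
  rw [← integral_finsetSum _ fun a _ => i a]
  simp_rw [← treeExp_sum, sum_draws]
  have hint : Integrable (fun s => A.treeExp p X s K (fun h => (h.length : ℝ)) [])
      (A.seedLaw : Measure A.Seed) := by
    have := integrable_finsetSum Finset.univ fun a _ => i a
    simpa only [← treeExp_sum, sum_draws] using this
  rw [← ENNReal.ofReal_le_ofReal_iff hS0, ofReal_integral_eq_lintegral_ofReal hint
    (Filter.Eventually.of_forall fun s => A.treeExp_nonneg hν.nonneg hν.le_one K
      (fun h => Nat.cast_nonneg h.length) []),
    ← A.lintegral_history hν (F := fun _ h => (h.length : ℝ))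
      (fun _ h => Nat.cast_nonneg h.length) (fun _ => measurable_const) K]
  refine le_trans (lintegral_mono fun z => ?_) hS
  rw [ENNReal.ofReal_natCast]
  exact le_iSup (fun k => ((A.history z.1 z.2 k).length : ℝ≥0∞)) K

/-- Stopping is absorbing, so the events increase with the horizon and continuity from below
applies. The strict slack pays for cutting off at a finite time. -/
theorem eventually_le_measure_halts (ν : Rewards n d) (R : (Fin q → Finset (Fin n)) → Prop)
    {c c' : ℝ≥0∞} (hc : c' < c) (h : c ≤ A.runLaw ν {z | ∃ out, A.Returns z.1 z.2 out ∧ R out}) :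
    ∀ᶠ K in Filter.atTop, c' ≤
      A.runLaw ν {z | ∃ out, A.act z.1 (A.history z.1 z.2 K) = Sum.inr out ∧ R out} := by
  have hU : {z : A.Seed × (ℕ → Fin n → Fin d → ℝ) | ∃ out, A.Returns z.1 z.2 out ∧ R out} =
      ⋃ K, {z | ∃ out, A.act z.1 (A.history z.1 z.2 K) = Sum.inr out ∧ R out} := by
    ext z
    simp only [Returns, Set.mem_ofPred_eq, Set.mem_iUnion]
    constructor
    · rintro ⟨o, ⟨k, hk⟩, ho⟩
      exact ⟨k, o, hk, ho⟩
    · rintro ⟨k, o, hk, ho⟩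
      exact ⟨o, ⟨k, hk⟩, ho⟩
  have hm : Monotone fun K => {z : A.Seed × (ℕ → Fin n → Fin d → ℝ) |
      ∃ out, A.act z.1 (A.history z.1 z.2 K) = Sum.inr out ∧ R out} := by
    rintro k k' hk z ⟨o, ho, hR⟩
    obtain ⟨j, rfl⟩ := Nat.exists_eq_add_of_le hk
    exact ⟨o, by rw [A.history_of_inr rfl ho]; exact ho, hR⟩
  have := tendsto_measure_iUnion_atTop (μ := A.runLaw ν) hm
  rw [← hU] at this
  exact (this.eventually (lt_mem_nhds (hc.trans_le h))).mono fun _ h => h.le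

end Algorithm

/-! ### Averaging over a product prior -/

section Prior

variable {G J : Type*} [Fintype G] [Fintype J]

/-- The weight of one coordinate in the product prior: `1/4` for `none`, and `3/4` spread
uniformly over the other values. -/
noncomputable def coordWeight (x : Option J) : ℝ :=
  if x = none then 1 / 4 else 3 / (4 * Fintype.card J)

/-- The product prior on configurations. -/
noncomputable def prior (θ : G → Option J) : ℝ := ∏ g, coordWeight (θ g)

theorem coordWeight_nonneg (x : Option J) : 0 ≤ coordWeight x := by
  unfold coordWeight; split_ifs <;> positivity

theorem prior_nonneg (θ : G → Option J) : 0 ≤ prior θ :=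
  Finset.prod_nonneg fun _ _ => coordWeight_nonneg _

theorem sum_prior [DecidableEq G] [Nonempty J] : ∑ θ : G → Option J, prior θ = 1 := by
  have hJ : (Fintype.card J : ℝ) ≠ 0 := by positivity
  have h1 : ∑ x : Option J, coordWeight x = 1 := by
    simp only [Fintype.sum_option, coordWeight, if_true, reduceCtorEq, if_false,
      Finset.sum_const, Finset.card_univ, nsmul_eq_mul]
    field_simp
    norm_num
  have := Finset.prod_univ_sum (fun _ : G => (Finset.univ : Finset (Option J)))
    fun _ x => coordWeight x
  simp only [h1, Finset.prod_const_one, Fintype.piFinset_univ] at this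
  exact this.symm

theorem prior_update [DecidableEq G] {θ : G → Option J} {g : G} (hg : θ g = none) (j : J) :
    prior (Function.update θ g (some j)) = 3 / Fintype.card J * prior θ := by
  unfold prior
  rw [← Finset.mul_prod_erase _ _ (Finset.mem_univ g),
    ← Finset.mul_prod_erase _ (fun i => coordWeight (θ i)) (Finset.mem_univ g)]
  have : ∀ i ∈ Finset.univ.erase g, coordWeight (Function.update θ g (some j) i) =
      coordWeight (θ i) := fun i hi => by
    rw [Function.update_of_ne (Finset.ne_of_mem_erase hi)]
  rw [Finset.prod_congr rfl this, Function.update_self, hg]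
  simp only [coordWeight, reduceCtorEq, if_false, if_true]
  by_cases hJ : (Fintype.card J : ℝ) = 0
  · simp [hJ]
  · field_simp

variable [DecidableEq G] [DecidableEq J]

/-- Reindexing along the bijection that fills the empty coordinate `g` with `j`. -/
theorem sum_update (g : G) (j : J) (f : (G → Option J) → ℝ) :
    ∑ θ with θ g = none, f (Function.update θ g (some j)) = ∑ θ with θ g = some j, f θ := by
  refine Finset.sum_bij' (fun θ _ => Function.update θ g (some j))
    (fun θ _ => Function.update θ g none) ?_ ?_ ?_ ?_ ?_
  · intro θ _; simp
  · intro θ _; simp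
  · intro θ hθ
    rw [Finset.mem_filter] at hθ
    simp [← hθ.2]
  · intro θ hθ
    rw [Finset.mem_filter] at hθ
    simp [← hθ.2]
  · intro θ _; rfl

theorem sum_prior_none [Nonempty J] (g : G) :
    ∑ θ : G → Option J with θ g = none, prior θ = 1 / 4 := by
  have hJ : (Fintype.card J : ℝ) ≠ 0 := by positivity
  have h1 : ∀ j : J, ∑ θ : G → Option J with θ g = some j, prior θ =
      3 / Fintype.card J * ∑ θ : G → Option J with θ g = none, prior θ := by
    intro j
    rw [← sum_update, Finset.mul_sum]
    exact Finset.sum_congr rfl fun θ hθ => prior_update (Finset.mem_filter.1 hθ).2 j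
  have h2 := Finset.sum_fiberwise (s := Finset.univ) (fun θ : G → Option J => θ g) prior
  rw [sum_prior, Fintype.sum_option] at h2
  simp only [h1, Finset.sum_const, Finset.card_univ, nsmul_eq_mul] at h2
  field_simp at h2
  linarith

/-- Emptying different filled coordinates of θ gives different configurations, none equal to θ.
Their total probability is thus at most the error probability; a separate bound δ for each would
lose the factor |G|. -/
theorem sum_update_none_le {δ : ℝ} (θ : G → Option J) {f : (G → Option J) → ℝ}
    (hf : ∀ θ, 0 ≤ f θ) (hsum : ∑ θ, f θ ≤ 1) (hθ : 1 - δ ≤ f θ) :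
    ∑ g with θ g ≠ none, f (Function.update θ g none) ≤ δ := by
  have hinj : Set.InjOn (fun g => Function.update θ g none)
      (Finset.univ.filter fun g => θ g ≠ none : Finset G) := by
    intro g hg g' _ h
    by_contra hne
    have := congrFun h g
    simp only [Function.update_self, Function.update_of_ne hne] at this
    simp only [Finset.coe_filter, Finset.mem_univ, true_and, Set.mem_ofPred_eq] at hg
    exact hg this.symm
  rw [← Finset.sum_image (f := f) hinj]
  have hsub : (Finset.univ.filter fun g => θ g ≠ none).image
      (fun g => Function.update θ g none) ⊆ Finset.univ.erase θ := by
    intro θ' h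
    obtain ⟨g, hg, rfl⟩ := Finset.mem_image.1 h
    refine Finset.mem_erase.2 ⟨fun h => (Finset.mem_filter.1 hg).2 ?_, Finset.mem_univ _⟩
    rw [← h, Function.update_self]
  have := Finset.sum_le_sum_of_subset_of_nonneg hsub fun i _ _ => hf i
  have h2 := Finset.add_sum_erase Finset.univ f (Finset.mem_univ θ)
  linarith

/-- Averaging the pairwise testing inequalities over the product prior. Here `a θ θ'` is the
probability, under `θ`, of an answer that is right for `θ'`, and `N θ g j` is the expected number
of draws, under `θ`, of the arm `j` in the group `g`. -/
theorem prior_average [Nonempty J] [Nonempty G] {a : (G → Option J) → (G → Option J) → ℝ}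
    {N : (G → Option J) → G → J → ℝ} {δ κ S u v : ℝ} (huv : u ≤ v) (hκ : 0 ≤ κ)
    (ha0 : ∀ θ θ', 0 ≤ a θ θ') (ha1 : ∀ θ, ∑ θ', a θ θ' ≤ 1) (haδ : ∀ θ, 1 - δ ≤ a θ θ)
    (hN0 : ∀ θ g j, 0 ≤ N θ g j) (hNS : ∀ θ, ∑ g, ∑ j, N θ g j ≤ S)
    (htest : ∀ θ g j, θ g = none → u + (v - u) * a θ θ ≤ κ * N θ g j +
      (Real.exp u + (Real.exp v - Real.exp u) * a (Function.update θ g (some j)) θ - 1)) :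
    u + (v - u) * (1 - δ) ≤ κ * (4 * S / (Fintype.card G * Fintype.card J)) +
      (Real.exp u + (Real.exp v - Real.exp u) * (4 * δ / (3 * Fintype.card G)) - 1) := by
  have hJ : (0 : ℝ) < Fintype.card J := by positivity
  have hG : (0 : ℝ) < Fintype.card G := by positivity
  obtain ⟨c, hc⟩ : ∃ c : ℝ, c = Fintype.card J := ⟨_, rfl⟩
  rw [← hc] at hJ ⊢
  have hexp : 0 ≤ Real.exp v - Real.exp u := sub_nonneg.2 (Real.exp_le_exp.2 huv)
  set L : ℝ := u + (v - u) * (1 - δ) - (Real.exp u - 1) with hL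
  have h1 : ∀ g, ∀ j : J, (1 / 4) * L ≤
      κ * ∑ θ : G → Option J with θ g = none, prior θ * N θ g j +
        (Real.exp v - Real.exp u) * ∑ θ : G → Option J with θ g = none,
          prior θ * a (Function.update θ g (some j)) θ := by
    intro g j
    rw [← sum_prior_none (J := J) g, Finset.sum_mul, Finset.mul_sum, Finset.mul_sum,
      ← Finset.sum_add_distrib]
    refine Finset.sum_le_sum fun θ hθ => ?_
    have h2 := htest θ g j (Finset.mem_filter.1 hθ).2
    have h3 := mul_le_mul_of_nonneg_left (haδ θ) (sub_nonneg.2 huv)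
    have h4 : L ≤ κ * N θ g j +
        (Real.exp v - Real.exp u) * a (Function.update θ g (some j)) θ := by
      rw [hL]; linarith
    have h5 := mul_le_mul_of_nonneg_left h4 (prior_nonneg θ)
    linarith
  have h2 : ∑ g, ∑ j, ∑ θ : G → Option J with θ g = none, prior θ * N θ g j ≤ S := by
    calc _ ≤ ∑ g, ∑ j, ∑ θ : G → Option J, prior θ * N θ g j := by
          refine Finset.sum_le_sum fun g _ => Finset.sum_le_sum fun j _ => ?_
          exact Finset.sum_le_sum_of_subset_of_nonneg (Finset.filter_subset _ _)
            fun θ _ _ => mul_nonneg (prior_nonneg θ) (hN0 θ g j)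
      _ = ∑ θ : G → Option J, prior θ * ∑ g, ∑ j, N θ g j := by
          simp_rw [Finset.mul_sum]
          simp_rw [Finset.sum_comm (s := (Finset.univ : Finset J)),
            Finset.sum_comm (s := (Finset.univ : Finset G))]
      _ ≤ ∑ θ : G → Option J, prior θ * S :=
          Finset.sum_le_sum fun θ _ => mul_le_mul_of_nonneg_left (hNS θ) (prior_nonneg θ)
      _ = S := by rw [← Finset.sum_mul, sum_prior, one_mul]
  have h3 : ∑ g, ∑ j, ∑ θ : G → Option J with θ g = none,
      prior θ * a (Function.update θ g (some j)) θ ≤ c / 3 * δ := by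
    -- Resum over the raised configuration, under which the probability is taken; the change of
    -- prior weight gives |J|/3.
    have e1 : ∀ g, ∀ j : J, ∑ θ : G → Option J with θ g = none,
        prior θ * a (Function.update θ g (some j)) θ =
        c / 3 * ∑ θ : G → Option J with θ g = some j,
          prior θ * a θ (Function.update θ g none) := by
      intro g j
      rw [← sum_update g j fun θ => prior θ * a θ (Function.update θ g none), Finset.mul_sum]
      refine Finset.sum_congr rfl fun θ hθ => ?_
      have hθ' := (Finset.mem_filter.1 hθ).2
      rw [prior_update hθ', ← hc, Function.update_idem, ← hθ', Function.update_eq_self]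
      field_simp
    have e2 : ∀ g, ∑ j, ∑ θ : G → Option J with θ g = some j,
        prior θ * a θ (Function.update θ g none) =
        ∑ θ : G → Option J with θ g ≠ none, prior θ * a θ (Function.update θ g none) := by
      intro g
      have := Finset.sum_fiberwise (s := Finset.univ) (fun θ : G → Option J => θ g)
        fun θ => prior θ * a θ (Function.update θ g none)
      rw [Fintype.sum_option, ← Finset.sum_filter_add_sum_filter_not Finset.univ
        (fun θ : G → Option J => θ g = none)] at this
      exact add_left_cancel this
    have e3 : ∑ g, ∑ θ : G → Option J with θ g ≠ none,
        prior θ * a θ (Function.update θ g none) =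
        ∑ θ, prior θ * ∑ g with θ g ≠ none, a θ (Function.update θ g none) := by
      simp_rw [Finset.sum_filter, Finset.mul_sum, Finset.sum_comm (s := (Finset.univ : Finset G)),
        mul_ite, mul_zero]
    simp_rw [e1, ← Finset.mul_sum, e2, e3]
    refine mul_le_mul_of_nonneg_left ?_ (by positivity)
    calc _ ≤ ∑ θ : G → Option J, prior θ * δ :=
          Finset.sum_le_sum fun θ _ => mul_le_mul_of_nonneg_left
            (sum_update_none_le θ (ha0 θ) (ha1 θ) (haδ θ)) (prior_nonneg θ)
      _ = δ := by rw [← Finset.sum_mul, sum_prior, one_mul]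
  have h4 := Finset.sum_le_sum fun g (_ : g ∈ (Finset.univ : Finset G)) =>
    Finset.sum_le_sum fun j (_ : j ∈ (Finset.univ : Finset J)) => h1 g j
  simp only [Finset.sum_add_distrib, ← Finset.mul_sum, Finset.sum_const, Finset.card_univ,
    nsmul_eq_mul, ← hc] at h4
  have h5 : 1 / 4 * (c * (Fintype.card G * L)) ≤
      κ * S + (Real.exp v - Real.exp u) * (c / 3 * δ) :=
    h4.trans (add_le_add (mul_le_mul_of_nonneg_left h2 hκ) (mul_le_mul_of_nonneg_left h3 hexp))
  have h6 : L ≤ κ * (4 * S / (Fintype.card G * c)) +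
      (Real.exp v - Real.exp u) * (4 * δ / (3 * Fintype.card G)) := by
    -- Normalise by |G| |J| / 4, the number of pairs (g, j) times the prior weight of an empty
    -- coordinate.
    rw [← mul_le_mul_iff_right₀ (show 0 < Fintype.card G * (c * (1 / 4)) by positivity)]
    calc _ = 1 / 4 * (c * (Fintype.card G * L)) := by ring
      _ ≤ _ := h5
      _ = _ := by field_simp
  rw [hL] at h6
  linarith

end Prior

/-! ### The hard instance -/

/-- The groups of arms: a cluster on the line together with a cell of the `d`-dimensional grid. -/
abbrev Group (τ k d : ℕ) : Type := Fin τ × (Fin d → Fin k)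

/-- The position of a grid cell in an order that extends the componentwise one. -/
def cellIndex {k d : ℕ} (c : Fin d → Fin k) : ℕ := finFunctionFinEquiv c

theorem cellIndex_lt {k d : ℕ} (c : Fin d → Fin k) : cellIndex c < k ^ d :=
  (finFunctionFinEquiv c).isLt

/-- The index reads the cell as digits in base k, so it is monotone in each coordinate and
injective. -/
theorem exists_lt_of_cellIndex_le {k d : ℕ} {c c' : Fin d → Fin k}
    (h : cellIndex c' ≤ cellIndex c) (hne : c' ≠ c) : ∃ j, c' j < c j := by
  by_contra! H
  refine hne (finFunctionFinEquiv.injective (Fin.ext (le_antisymm h ?_)))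
  rw [finFunctionFinEquiv_apply, finFunctionFinEquiv_apply]
  exact Finset.sum_le_sum fun j _ => Nat.mul_le_mul_right _ (H j)

section HardInstance

variable {τ k d n q : ℕ} {J : Type*}

/-- The hard instance: the clusters are far apart, and within a cluster the groups are ordered by
`cellIndex`. There is one interval for each group; it contains the arms of the same cluster up
to this group. -/
noncomputable def hardInstance (e : Fin n ≃ Group τ k d × Option J)
    (r : Fin q ≃ Group τ k d) : Instance n q where
  -- The last term lies in [0, 1/2): it makes the points distinct without moving any past the right
  -- endpoint of its group.
  point a := 4 * (k : ℝ) ^ d * ((e a).1.1 : ℕ) + cellIndex (e a).1.2 + ((a : ℕ) : ℝ) / (2 * n)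
  left i := 4 * (k : ℝ) ^ d * ((r i).1 : ℕ) - 1
  right i := 4 * (k : ℝ) ^ d * ((r i).1 : ℕ) + cellIndex (r i).2 + 1 / 2
  left_lt_right i := by
    have : (0 : ℝ) ≤ cellIndex (r i).2 := Nat.cast_nonneg _
    linarith

variable {e : Fin n ≃ Group τ k d × Option J} {r : Fin q ≃ Group τ k d}

theorem lt_of_spaced_lt {N : ℝ} (hN : 1 ≤ N) {s t : ℕ} (h : 4 * N * s < 4 * N * t + 4 * N) :
    s ≤ t := by
  have h1 : 4 * N * s < 4 * N * ((t : ℝ) + 1) := by linarith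
  have h2 := lt_of_mul_lt_mul_left h1 (by linarith)
  exact Nat.lt_succ_iff.1 (by exact_mod_cast h2)

theorem mem_arms_hardInstance (hk : 1 ≤ k) {i : Fin q} {a : Fin n} :
    a ∈ (hardInstance e r).arms i ↔
      (e a).1.1 = (r i).1 ∧ cellIndex (e a).1.2 ≤ cellIndex (r i).2 := by
  have hN : (1 : ℝ) ≤ (k : ℝ) ^ d := one_le_pow₀ (by exact_mod_cast hk)
  have hn : (0 : ℝ) < n := by exact_mod_cast a.pos
  have ho : (0 : ℝ) ≤ ((a : ℕ) : ℝ) / (2 * n) := by positivity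
  have ho' : ((a : ℕ) : ℝ) / (2 * n) < 1 / 2 := by
    rw [div_lt_iff₀ (by positivity)]
    have : ((a : ℕ) : ℝ) < n := by exact_mod_cast a.isLt
    linarith
  have h1 : (cellIndex (e a).1.2 : ℝ) + 1 ≤ (k : ℝ) ^ d := by
    exact_mod_cast cellIndex_lt (e a).1.2
  have h2 : (cellIndex (r i).2 : ℝ) + 1 ≤ (k : ℝ) ^ d := by exact_mod_cast cellIndex_lt (r i).2
  have h1' : (0 : ℝ) ≤ cellIndex (e a).1.2 := Nat.cast_nonneg _
  have h2' : (0 : ℝ) ≤ cellIndex (r i).2 := Nat.cast_nonneg _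
  simp only [Instance.arms, hardInstance, Set.mem_ofPred_eq]
  constructor
  · rintro ⟨hl, hr⟩
    have ht : (e a).1.1 = (r i).1 := Fin.ext <| le_antisymm
      (lt_of_spaced_lt hN (by linarith)) (lt_of_spaced_lt hN (by linarith))
    refine ⟨ht, ?_⟩
    rw [ht] at hr
    have : (cellIndex (e a).1.2 : ℝ) < cellIndex (r i).2 + 1 := by linarith
    exact Nat.lt_succ_iff.1 (by exact_mod_cast this)
  · rintro ⟨ht, hc⟩
    have hc' : (cellIndex (e a).1.2 : ℝ) ≤ cellIndex (r i).2 := by exact_mod_cast hc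
    rw [ht]
    constructor <;> linarith

/-- All intervals of a cluster share a point just left of its arms, while intervals of different
clusters are disjoint by the spacing 4 k^d. -/
theorem hasHittingNumber_hardInstance (hk : 1 ≤ k) :
    (hardInstance e r).HasHittingNumber τ := by
  have hN : (1 : ℝ) ≤ (k : ℝ) ^ d := one_le_pow₀ (by exact_mod_cast hk)
  constructor
  · have hinj : Function.Injective fun t : Fin τ => 4 * (k : ℝ) ^ d * (t : ℕ) - 1 / 2 := by
      intro s t h
      have h1 : 4 * (k : ℝ) ^ d * (s : ℕ) = 4 * (k : ℝ) ^ d * (t : ℕ) := by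
        simpa using h
      have h2 := mul_left_cancel₀ (by positivity) h1
      exact Fin.ext (by exact_mod_cast h2)
    refine ⟨Finset.univ.map ⟨_, hinj⟩, fun i => ?_, by simp⟩
    refine ⟨_, Finset.mem_map_of_mem _ (Finset.mem_univ (r i).1), ?_⟩
    have h2' : (0 : ℝ) ≤ cellIndex (r i).2 := Nat.cast_nonneg _
    simp only [hardInstance, Function.Embedding.coeFn_mk]
    constructor <;> linarith
  · rintro _ ⟨H, hH, rfl⟩
    have : NeZero k := ⟨by omega⟩
    choose f hfH hfl hfr using fun t : Fin τ => hH (r.symm (t, fun _ => 0))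
    have hinj : Function.Injective f := by
      intro s t h
      have hs := hfl s
      have hs' := hfr s
      have ht := hfl t
      have ht' := hfr t
      simp only [hardInstance, Equiv.apply_symm_apply] at hs hs' ht ht'
      rw [h] at hs hs'
      have h2 : (cellIndex (fun _ : Fin d => (0 : Fin k)) : ℝ) + 1 ≤ (k : ℝ) ^ d := by
        exact_mod_cast cellIndex_lt (fun _ : Fin d => (0 : Fin k))
      exact Fin.ext <| le_antisymm
        (lt_of_spaced_lt hN (by linarith)) (lt_of_spaced_lt hN (by linarith))
    calc τ = (Finset.univ.image f).card := by
          rw [Finset.card_image_of_injective _ hinj, Finset.card_univ, Fintype.card_fin]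
      _ ≤ H.card := Finset.card_le_card fun x hx => by
          obtain ⟨t, _, rfl⟩ := Finset.mem_image.1 hx
          exact hfH t

/-- The two values of the reward of an arm. -/
noncomputable def hardValue (e : Fin n ≃ Group τ k d × Option J) (ε : ℝ) (a : Fin n)
    (b : Bool) (j : Fin d) : ℝ :=
  -- One coin is shared by all coordinates, so a draw reveals a single bit whatever d is. Heads
  -- probability 1/2 + 2εℓ shifts the mean by εℓ.
  1 / 4 + 4 * ε * ((e a).1.2 j : ℕ) + if b then 1 / 4 else -(1 / 4)

theorem hardValue_mem {ε : ℝ} (hε : 0 < ε) (hεk : 8 * ε * k ≤ 1) (a : Fin n) (b : Bool)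
    (j : Fin d) : hardValue e ε a b j ∈ Set.Icc (0 : ℝ) 1 := by
  have h1 : (((e a).1.2 j : ℕ) : ℝ) ≤ k := by exact_mod_cast ((e a).1.2 j).isLt.le
  have h2 := mul_le_mul_of_nonneg_left h1 hε.le
  have h3 : 0 ≤ ε * (((e a).1.2 j : ℕ) : ℝ) := by positivity
  unfold hardValue
  constructor <;> cases b <;> simp <;> linarith

variable [DecidableEq J]

/-- The bump of the arm `i` in a group whose configuration is `x`. -/
def level (x i : Option J) : ℝ := if i = none then 1 else if i = x then 2 else 0

theorem level_nonneg (x i : Option J) : 0 ≤ level x i := by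
  unfold level; split_ifs <;> norm_num

theorem level_le_two (x i : Option J) : level x i ≤ 2 := by
  unfold level; split_ifs <;> norm_num

theorem one_le_level_self (x : Option J) : 1 ≤ level x x := by
  unfold level; split_ifs <;> simp_all

/-- Levels 0, 1, 2 give the best arm a lead of at least one unit ε, just enough to exclude its
rivals, while changing the configuration from `none` to `some j` alters only the arm j. -/
theorem level_add_one_le {x i : Option J} (h : i ≠ x) : level x i + 1 ≤ level x x := by
  unfold level
  rcases x with _ | x <;> rcases i with _ | i <;> simp_all
  norm_num

/-- The mean vectors of the arms in the configuration `θ`. -/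
noncomputable def hardWeight (e : Fin n ≃ Group τ k d × Option J) (ε : ℝ)
    (θ : Group τ k d → Option J) (a : Fin n) (j : Fin d) : ℝ :=
  1 / 4 + 4 * ε * ((e a).1.2 j : ℕ) + ε * level (θ (e a).1) (e a).2

/-- The answers that are right in the configuration `θ`. -/
def IsRight (e : Fin n ≃ Group τ k d × Option J) (r : Fin q ≃ Group τ k d) (ε : ℝ)
    (θ : Group τ k d → Option J) (out : Fin q → Finset (Fin n)) : Prop :=
  ∀ i, (hardInstance e r).IsParetoOptimal (hardWeight e ε θ) ε i (out i)

/-- Within the group, every arm but the best is dominated by ε and hence excluded. The best arm must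
be covered, and no arm of another group in the interval can do so. -/
theorem IsRight.mem_iff {ε : ℝ} (hε : 0 < ε) (hk : 1 ≤ k) {θ : Group τ k d → Option J}
    {out : Fin q → Finset (Fin n)} (h : IsRight e r ε θ out) (g : Group τ k d)
    (x : Option J) : e.symm (g, x) ∈ out (r.symm g) ↔ x = θ g := by
  obtain ⟨hsub, hcov, hpar⟩ := h (r.symm g)
  have hb : ∀ y, e.symm (g, y) ∈ (hardInstance e r).arms (r.symm g) := by
    intro y
    rw [mem_arms_hardInstance hk]
    simp
  have huniq : ∀ y, e.symm (g, y) ∈ out (r.symm g) → y = θ g := by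
    intro y hy
    by_contra hne
    refine hpar _ hy ⟨_, hb (θ g), fun j => ?_⟩
    have := mul_le_mul_of_nonneg_left (level_add_one_le hne) hε.le
    simp only [hardWeight, Pi.add_apply, Equiv.apply_symm_apply]
    linarith
  refine ⟨huniq x, ?_⟩
  rintro rfl
  obtain ⟨a, ha, hle⟩ := hcov _ (hb (θ g))
  obtain ⟨⟨⟨t, c⟩, y⟩, rfl⟩ := e.symm.surjective a
  have hmem := hsub _ ha
  rw [mem_arms_hardInstance hk] at hmem
  simp only [Equiv.apply_symm_apply] at hmem
  obtain ⟨rfl, hc⟩ := hmem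
  -- Another cell in the interval trails by at least 4ε in some coordinate; the levels and the
  -- tolerance together recover at most 2ε.
  have hcg : c = g.2 := by
    by_contra hne
    obtain ⟨j, hj⟩ := exists_lt_of_cellIndex_le hc hne
    have h1 := hle j
    simp only [hardWeight, Pi.sub_apply, Equiv.apply_symm_apply] at h1
    have h2 : ((c j : ℕ) : ℝ) + 1 ≤ ((g.2 j : ℕ) : ℝ) := by exact_mod_cast hj
    have h3 := mul_le_mul_of_nonneg_left (level_le_two (θ (g.1, c)) y) hε.le
    have h4 := mul_le_mul_of_nonneg_left (one_le_level_self (θ g)) hε.le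
    have h5 := mul_le_mul_of_nonneg_left h2 hε.le
    linarith
  subst hcg
  rw [← huniq y ha]
  exact ha

theorem IsRight.unique {ε : ℝ} (hε : 0 < ε) (hk : 1 ≤ k) {θ θ' : Group τ k d → Option J}
    {out : Fin q → Finset (Fin n)} (h : IsRight e r ε θ out) (h' : IsRight e r ε θ' out) :
    θ = θ' :=
  funext fun g => (h'.mem_iff hε hk g (θ g)).1 ((h.mem_iff hε hk g (θ g)).2 rfl)

/-- The probability of the larger reward of an arm, in the configuration `θ`. -/
noncomputable def hardProb (e : Fin n ≃ Group τ k d × Option J) (ε : ℝ)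
    (θ : Group τ k d → Option J) (a : Fin n) : ℝ :=
  1 / 2 + 2 * ε * level (θ (e a).1) (e a).2

theorem hardProb_nonneg {ε : ℝ} (hε : 0 < ε) (θ : Group τ k d → Option J) (a : Fin n) :
    0 ≤ hardProb e ε θ a := by
  have := mul_nonneg hε.le (level_nonneg (θ (e a).1) (e a).2)
  unfold hardProb
  linarith

theorem hardProb_le_one {ε : ℝ} (hε : 0 < ε) (hε' : ε ≤ 1 / 16) (θ : Group τ k d → Option J)
    (a : Fin n) : hardProb e ε θ a ≤ 1 := by
  have := mul_le_mul_of_nonneg_left (level_le_two (θ (e a).1) (e a).2) hε.le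
  unfold hardProb
  linarith

/-- The reward distributions in the configuration `θ`. -/
noncomputable def hardRewards (e : Fin n ≃ Group τ k d × Option J) {ε : ℝ} (hε : 0 < ε)
    (hε' : ε ≤ 1 / 16) (hεk : 8 * ε * k ≤ 1) (θ : Group τ k d → Option J) : Rewards n d where
  law a := ⟨ENNReal.ofReal (hardProb e ε θ a) • Measure.dirac (hardValue e ε a true) +
      ENNReal.ofReal (1 - hardProb e ε θ a) • Measure.dirac (hardValue e ε a false), ⟨by
    simp only [Measure.add_apply, Measure.smul_apply, measure_univ, smul_eq_mul, mul_one]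
    rw [← ENNReal.ofReal_add (hardProb_nonneg hε θ a)
      (sub_nonneg.2 (hardProb_le_one hε hε' θ a))]
    simp⟩⟩
  mem_cube a := by
    simp only [ProbabilityMeasure.coe_mk]
    rw [ae_add_measure_iff]
    exact ⟨Measure.ae_smul_measure (by
        rw [ae_dirac_eq]; exact fun j => hardValue_mem hε hεk a true j) _,
      Measure.ae_smul_measure (by
        rw [ae_dirac_eq]; exact fun j => hardValue_mem hε hεk a false j) _⟩

theorem isTwoPoint_hardRewards {ε : ℝ} (hε : 0 < ε) (hε' : ε ≤ 1 / 16)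
    (hεk : 8 * ε * k ≤ 1) (hd : 1 ≤ d) (θ : Group τ k d → Option J) :
    (hardRewards e hε hε' hεk θ).IsTwoPoint (hardProb e ε θ) (hardValue e ε) where
  ne a h := by
    have := congrFun h ⟨0, hd⟩
    simp only [hardValue, if_true, Bool.false_eq_true, if_false] at this
    linarith
  nonneg := hardProb_nonneg hε θ
  le_one := hardProb_le_one hε hε' θ
  law_eq _ := rfl

theorem weight_hardRewards {ε : ℝ} (hε : 0 < ε) (hε' : ε ≤ 1 / 16)
    (hεk : 8 * ε * k ≤ 1) (θ : Group τ k d → Option J) :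
    (hardRewards e hε hε' hεk θ).weight = hardWeight e ε θ := by
  funext a j
  have hi : ∀ x : Fin d → ℝ, ∀ c : ℝ, Integrable (fun y : Fin d → ℝ => y j)
      (ENNReal.ofReal c • Measure.dirac x) := fun x c => by
    refine Integrable.smul_measure ?_ ENNReal.ofReal_ne_top
    exact integrable_dirac (by finiteness)
  simp only [Rewards.weight, hardRewards, ProbabilityMeasure.coe_mk]
  rw [integral_add_measure (hi _ _) (hi _ _), integral_smul_measure, integral_smul_measure,
    integral_dirac, integral_dirac, ENNReal.toReal_ofReal (hardProb_nonneg hε θ a),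
    ENNReal.toReal_ofReal (sub_nonneg.2 (hardProb_le_one hε hε' θ a))]
  simp only [hardValue, hardProb, hardWeight, smul_eq_mul, if_true, Bool.false_eq_true, if_false]
  ring

/-- For the raised arm this is the divergence of a fair coin from one of bias 1/2 + 4ε, namely
-log(1 - 64ε²)/2. For all other arms the law is unchanged and only concavity of the logarithm
remains. -/
theorem hardProb_divergence {ε : ℝ} (hε : 0 < ε) (hε' : ε ≤ 1 / 16)
    {θ : Group τ k d → Option J} {g : Group τ k d} (hg : θ g = none)
    (j : J) (b : Fin n) {y z : ℝ} (hy : 0 < y) (hz : 0 < z) :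
    hardProb e ε θ b * Real.log y + (1 - hardProb e ε θ b) * Real.log z ≤
      (if b = e.symm (g, some j) then 43 * ε ^ 2 else 0) +
        Real.log (hardProb e ε (Function.update θ g (some j)) b * y +
          (1 - hardProb e ε (Function.update θ g (some j)) b) * z) := by
  split_ifs with hb
  · have h1 : hardProb e ε θ b = 1 / 2 := by
      simp [hardProb, level, hb, hg]
    have h2 : hardProb e ε (Function.update θ g (some j)) b = 1 / 2 + 4 * ε := by
      simp [hardProb, level, hb]
      ring
    rw [h1, h2]
    have h3 : (0 : ℝ) < 1 / 2 + 4 * ε := by linarith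
    have h4 : (0 : ℝ) < 1 / 2 - 4 * ε := by linarith
    have h5 : 0 < (1 / 2 + 4 * ε) * y + (1 - (1 / 2 + 4 * ε)) * z := by
      have := mul_pos h3 hy
      have := mul_pos h4 hz
      linarith
    -- AM-GM for the two terms of the mixture, with 4(1/2 + 4ε)(1/2 - 4ε) = 1 - 64ε².
    have h6 : (1 - 64 * ε ^ 2) * (y * z) ≤
        ((1 / 2 + 4 * ε) * y + (1 - (1 / 2 + 4 * ε)) * z) ^ 2 := by
      nlinarith [sq_nonneg ((1 / 2 + 4 * ε) * y - (1 / 2 - 4 * ε) * z)]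
    have h7 : ε ^ 2 ≤ 1 / 256 := by nlinarith
    have h8 : (3 / 4 : ℝ) ≤ 1 - 64 * ε ^ 2 := by linarith
    have h9 := Real.log_le_log (by positivity) h6
    rw [Real.log_mul (by linarith) (by positivity), Real.log_mul hy.ne' hz.ne',
      Real.log_pow] at h9
    have h10 := Real.one_sub_inv_le_log_of_pos (show 0 < 1 - 64 * ε ^ 2 by linarith)
    -- 64/(3/4) < 86, and half of 86 is the constant 43.
    have h11 : (1 - 64 * ε ^ 2)⁻¹ ≤ 1 + 86 * ε ^ 2 := by
      rw [inv_le_iff_one_le_mul₀ (by linarith)]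
      nlinarith [sq_nonneg ε]
    push_cast at h9
    linarith
  · have h1 : hardProb e ε (Function.update θ g (some j)) b = hardProb e ε θ b := by
      unfold hardProb
      by_cases hbg : (e b).1 = g
      · have hne : (e b).2 ≠ some j := by
          intro h
          exact hb (by rw [Equiv.eq_symm_apply, ← hbg, ← h])
        rw [hbg, Function.update_self, hg]
        unfold level
        split_ifs <;> simp_all
      · rw [Function.update_of_ne hbg]
    rw [h1, zero_add]
    simpa using strictConcaveOn_log_Ioi.concaveOn.2 (Set.mem_Ioi.2 hy) (Set.mem_Ioi.2 hz)
      (hardProb_nonneg hε θ b) (sub_nonneg.2 (hardProb_le_one hε hε' θ b)) (by ring)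

end HardInstance

/-! ### Numerical estimates -/

theorem log_le_neg_log_four_mul {R : ℝ} (hR : 4 ≤ R) :
    Real.log R / 40 ≤ -Real.log (4 * (4 / (3 * R)) * (1 - 4 / (3 * R))) := by
  have hx : 4 / (3 * R) ≤ 1 / 3 := by
    rw [div_le_div_iff₀ (by positivity) (by positivity)]; linarith
  have hx0 : 0 < 4 / (3 * R) := by positivity
  set x := 4 / (3 * R) with hxR
  have hpos : 0 < 4 * x * (1 - x) := by
    have : 0 < 1 - x := by linarith
    positivity
  -- Below 64 the left side is bounded and 4x(1 - x) ≤ 8/9 suffices, which dictates the 40; above 64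
  -- the bound 8/R leaves half of log R.
  rcases le_total R 64 with h | h
  · have h1 : 4 * x * (1 - x) ≤ 8 / 9 := by nlinarith
    have h2 := Real.log_le_sub_one_of_pos hpos
    have h3 : Real.log R ≤ 6 * Real.log 2 := by
      have : Real.log R ≤ Real.log (2 ^ 6) := Real.log_le_log (by linarith) (by norm_num; exact h)
      rwa [Real.log_pow] at this
    have := Real.log_two_lt_d9
    linarith
  · have h1 : 4 * x * (1 - x) ≤ 8 / R := by
      have : 4 * x ≤ 8 / R := by
        rw [hxR, mul_div_assoc', div_le_div_iff₀ (by positivity) (by positivity)]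
        linarith
      nlinarith
    have h2 := Real.log_le_log hpos h1
    rw [Real.log_div (by norm_num) (by linarith), show (8 : ℝ) = 2 ^ 3 by norm_num,
      Real.log_pow] at h2
    have h3 : 6 * Real.log 2 ≤ Real.log R := by
      have : Real.log (2 ^ 6) ≤ Real.log R := Real.log_le_log (by norm_num) (by norm_num; exact h)
      rwa [Real.log_pow] at this
    have := Real.log_pos (show (1 : ℝ) < 2 by norm_num)
    push_cast at h2
    linarith

/-- The fourth power absorbs the 8 in 1/ε = 8k, since 8 ≤ k³. -/
theorem log_ratio_le {τ d k : ℕ} (hτ : 1 ≤ τ) (hk : 2 ≤ k) {ε δ : ℝ}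
    (hε : ε = 1 / (8 * (k : ℝ))) (hδ : 0 < δ) (hδ' : δ ≤ 1 / 2) :
    Real.log (τ / (ε ^ d * δ)) ≤ 4 * Real.log (((τ * k ^ d : ℕ) : ℝ) / δ) := by
  have hτ' : (1 : ℝ) ≤ τ := by exact_mod_cast hτ
  have hk' : (2 : ℝ) ≤ k := by exact_mod_cast hk
  have h1 : (τ : ℝ) / (ε ^ d * δ) = τ * (8 * k) ^ d * (1 / δ) := by
    rw [hε, one_div, inv_pow]
    field_simp
  have h2 : (τ : ℝ) ≤ τ ^ 4 := le_self_pow₀ hτ' (by norm_num)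
  have h3 : (8 * (k : ℝ)) ^ d ≤ (k ^ d) ^ 4 := by
    rw [← pow_mul, mul_comm d 4, pow_mul]
    refine pow_le_pow_left₀ (by positivity) ?_ d
    have : (2 : ℝ) ^ 3 ≤ k ^ 3 := pow_le_pow_left₀ (by norm_num) hk' 3
    nlinarith
  have h4 : 1 / δ ≤ (1 / δ) ^ 4 := le_self_pow₀ (by rw [le_div_iff₀ hδ]; linarith) (by norm_num)
  have h5 : (τ : ℝ) / (ε ^ d * δ) ≤ (((τ * k ^ d : ℕ) : ℝ) / δ) ^ 4 := by
    rw [h1]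
    calc _ ≤ (τ : ℝ) ^ 4 * (k ^ d) ^ 4 * (1 / δ) ^ 4 := by gcongr
      _ = _ := by push_cast; ring
  have h6 : 0 < (τ : ℝ) / (ε ^ d * δ) := by rw [h1]; positivity
  have := Real.log_le_log h6 h5
  rw [Real.log_pow] at this
  exact_mod_cast this

/-- Solving the averaged testing inequality, with optimal exponents, for the number of samples. -/
theorem log_le_of_prior_average {M δ B : ℝ} (hM : 2 ≤ M) (hδ : 0 < δ) (hδ' : δ ≤ 1 / 2)
    (h : ∀ u v η : ℝ, u ≤ v → 0 < η → η < 1 - δ → u + (v - u) * (1 - (δ + η)) ≤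
      B + (Real.exp u + (Real.exp v - Real.exp u) * (4 * (δ + η) / (3 * M)) - 1)) :
    Real.log (M / δ) / 80 ≤ B := by
  have hR : 4 ≤ M / δ := by rw [le_div_iff₀ hδ]; linarith
  have key := log_le_neg_log_four_mul hR
  have hxe : 4 / (3 * (M / δ)) = 4 * δ / (3 * M) := by field_simp
  have hx : 4 * δ / (3 * M) ≤ 1 / 3 := by
    rw [div_le_div_iff₀ (by positivity) (by positivity)]; linarith
  have hx0 : 0 < 4 * δ / (3 * M) := by positivity
  rw [hxe] at key
  set x := 4 * δ / (3 * M) with hxd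
  have hx1 : 0 < 1 - x := by linarith
  -- These are the log-likelihood ratios of a fair coin against a coin of bias x, so the exponential
  -- moment equals 1 and the correction term vanishes.
  set u := -Real.log (2 * (1 - x)) with hu
  set v := -Real.log (2 * x) with hv
  have huv : u ≤ v := neg_le_neg (Real.log_le_log (by positivity) (by linarith))
  have heu : Real.exp u = 1 / (2 * (1 - x)) := by
    rw [hu, Real.exp_neg, Real.exp_log (by positivity), one_div]
  have hev : Real.exp v = 1 / (2 * x) := by
    rw [hv, Real.exp_neg, Real.exp_log (by positivity), one_div]
  have hlim : u + (v - u) * (1 - δ) ≤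
      B + (Real.exp u + (Real.exp v - Real.exp u) * x - 1) := by
    -- The inequality is affine in the cut-off slack η, with slope D; let η tend to 0.
    set D := (v - u) + (Real.exp v - Real.exp u) * (4 / (3 * M)) with hD
    have hD0 : 0 ≤ D := by
      have := sub_nonneg.2 (Real.exp_le_exp.2 huv)
      have := sub_nonneg.2 huv
      positivity
    refine le_of_forall_pos_le_add fun t ht => ?_
    have hη : 0 < min (1 / 4) (t / (D + 1)) := by positivity
    have h1 := h u v _ huv hη (lt_of_le_of_lt (min_le_left _ _) (by linarith))
    have h2 : min (1 / 4) (t / (D + 1)) * D ≤ t := by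
      calc _ ≤ t / (D + 1) * (D + 1) := by
            gcongr
            · exact min_le_right _ _
            · linarith
        _ = t := by field_simp
    set η := min (1 / 4) (t / (D + 1))
    have h3 : 4 * (δ + η) / (3 * M) = x + η * (4 / (3 * M)) := by rw [hxd]; ring
    rw [h3] at h1
    rw [hD] at h2
    linarith
  have hzero : Real.exp u + (Real.exp v - Real.exp u) * x - 1 = 0 := by
    rw [heu, hev]
    field_simp
    ring
  have hsum : u + v = -Real.log (4 * x * (1 - x)) := by
    rw [hu, hv, ← neg_add, ← Real.log_mul (by positivity) (by positivity)]
    ring_nf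
  -- As 1 - δ ≥ 1/2, the left side is at least (u + v)/2, half of the quantity in `key`.
  have h4 := mul_le_mul_of_nonneg_left (show 1 / 2 ≤ 1 - δ by linarith) (sub_nonneg.2 huv)
  linarith

/-! ### Assembling the lower bound -/

section LowerBound

variable {τ k d n q : ℕ} {J : Type*} [Fintype J] [DecidableEq J] [Nonempty J]
  {e : Fin n ≃ Group τ k d × Option J} {r : Fin q ≃ Group τ k d} {ε : ℝ}

theorem hardInstance_lower_bound (hd : 1 ≤ d) (hk : 1 ≤ k) (hε : 0 < ε) (hε' : ε ≤ 1 / 16)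
    (hεk : 8 * ε * k ≤ 1) (hM : 2 ≤ Fintype.card (Group τ k d)) {δ : ℝ} (hδ : 0 < δ)
    (hδ' : δ ≤ 1 / 2) (A : Algorithm n d q) (hA : A.IsPAC (hardInstance e r) ε δ) {S : ℝ}
    (hS0 : 0 ≤ S) (hS : ∀ ν, A.expectedSamples ν ≤ ENNReal.ofReal S) :
    Real.log (Fintype.card (Group τ k d) / δ) / 80 ≤
      43 * ε ^ 2 * (4 * S / (Fintype.card (Group τ k d) * Fintype.card J)) := by
  have : Nonempty (Group τ k d) := Fintype.card_pos_iff.1 (by omega)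
  refine log_le_of_prior_average (by exact_mod_cast hM) hδ hδ' fun u v η huv hη hη' => ?_
  have hν := isTwoPoint_hardRewards (e := e) hε hε' hεk hd
  have hev : ∀ θ : Group τ k d → Option J, ∀ᶠ K in Filter.atTop,
      1 - (δ + η) ≤ A.runExp (hardProb e ε θ) (hardValue e ε) K
        (A.haltInd (IsRight e r ε θ)) := by
    intro θ
    have h1 := hA (hardRewards e hε hε' hεk θ)
    rw [weight_hardRewards] at h1
    have h2 : ENNReal.ofReal (1 - (δ + η)) < ENNReal.ofReal (1 - δ) :=
      (ENNReal.ofReal_lt_ofReal_iff (by linarith)).2 (by linarith)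
    filter_upwards [A.eventually_le_measure_halts _ (IsRight e r ε θ) h2 h1] with K hK
    exact (ENNReal.ofReal_le_ofReal_iff (A.runExp_haltInd_nonneg (hν θ).nonneg (hν θ).le_one _ _)).1
      (hK.trans (A.measure_halts_le (hν θ) _ K))
  -- There are finitely many configurations, so one horizon serves them all.
  obtain ⟨K, hK⟩ := (Filter.eventually_all.2 hev).exists
  refine prior_average (J := J)
    (a := fun θ θ' => A.runExp (hardProb e ε θ) (hardValue e ε) K (A.haltInd (IsRight e r ε θ')))
    (N := fun θ g j => A.runExp (hardProb e ε θ) (hardValue e ε) K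
      fun _ => Algorithm.draws (e.symm (g, some j)))
    huv (by positivity) ?_ ?_ hK ?_ ?_ ?_
  · exact fun θ θ' => A.runExp_haltInd_nonneg (hν θ).nonneg (hν θ).le_one _ K
  · exact fun θ => A.sum_runExp_haltInd_le (hν θ).nonneg (hν θ).le_one _
      (fun _ _ _ h h' => h.unique hε hk h') K
  · exact fun θ g j => A.runExp_draws_nonneg (hν θ).nonneg (hν θ).le_one _ K
  · intro θ
    refine le_trans ?_ (A.sum_runExp_draws_le (hν θ) K hS0 (hS _))
    rw [← e.symm.sum_comp, Fintype.sum_prod_type (α₂ := Option J)]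
    refine Finset.sum_le_sum fun g _ => ?_
    rw [Fintype.sum_option]
    have := A.runExp_draws_nonneg (hν θ).nonneg (hν θ).le_one (X := hardValue e ε)
      (e.symm (g, none)) K
    linarith
  · intro θ g j hg
    exact A.runExp_binary_le (hν θ).nonneg (hν θ).le_one (hν _).nonneg (hν _).le_one
      (fun b y z hy hz => hardProb_divergence hε hε' hg j b hy hz) K _ u v

end LowerBound

end BanditRange

theorem mainTheorem3 :
    ∃ C : ℝ, 0 < C ∧
      ∀ (τ d k m n : ℕ) (ε : ℝ), 1 ≤ τ → 1 ≤ d → 2 ≤ k → ε = 1 / (8 * (k : ℝ)) →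
        2 ≤ m → n = m * (τ * k ^ d) →
        ∃ (q : ℕ) (P : BanditRange.Instance n q), P.HasHittingNumber τ ∧
          ∀ δ : ℝ, 0 < δ → δ ≤ 1 / 2 →
            ∀ A : BanditRange.Algorithm n d q, A.IsPAC P ε δ →
              ∃ ν : BanditRange.Rewards n d,
                ENNReal.ofReal
                    (C * ((n : ℝ) / ε ^ 2 * Real.log ((τ : ℝ) / (ε ^ d * δ)))) ≤
                  A.expectedSamples ν := by
  -- Any C with 43 · 4 · 2 · C < 1/320 works: the 2 bounds m/(m - 1), and 320 = 80 · 4 comes from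
  -- the two logarithm estimates.
  refine ⟨1 / 200000, by norm_num, ?_⟩
  intro τ d k m n ε hτ hd hk hεk hm hn
  -- From here on m counts the arms of a group other than its base arm.
  obtain ⟨m, rfl⟩ : ∃ m', m = m' + 1 := ⟨m - 1, by omega⟩
  have hm1 : 1 ≤ m := by omega
  have : Nonempty (Fin m) := ⟨⟨0, hm1⟩⟩
  have hk' : (2 : ℝ) ≤ k := by exact_mod_cast hk
  have hε : 0 < ε := by rw [hεk]; positivity
  have hε' : ε ≤ 1 / 16 := by
    rw [hεk]; exact one_div_le_one_div_of_le (by norm_num) (by linarith)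
  have hε1 : 8 * ε * k ≤ 1 := by rw [hεk]; field_simp; exact le_refl _
  have hcard : Fintype.card (BanditRange.Group τ k d) = τ * k ^ d := by simp
  have hM : 2 ≤ τ * k ^ d := by
    calc 2 ≤ 1 * k ^ 1 := by rw [one_mul, pow_one]; exact hk
      _ ≤ τ * k ^ d := Nat.mul_le_mul hτ (Nat.pow_le_pow_right (by omega) hd)
  let e : Fin n ≃ BanditRange.Group τ k d × Option (Fin m) :=
    Fintype.equivOfCardEq (by
      rw [Fintype.card_prod, Fintype.card_option, Fintype.card_fin, Fintype.card_fin, hcard, hn,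
        mul_comm])
  let r : Fin (τ * k ^ d) ≃ BanditRange.Group τ k d :=
    Fintype.equivOfCardEq (by rw [Fintype.card_fin, hcard])
  refine ⟨τ * k ^ d, BanditRange.hardInstance e r,
    BanditRange.hasHittingNumber_hardInstance (by omega), fun δ hδ hδ' A hA => ?_⟩
  by_contra! H
  set Λ := Real.log ((τ : ℝ) / (ε ^ d * δ)) with hΛ
  set M : ℝ := ((τ * k ^ d : ℕ) : ℝ) with hMr
  have hM2 : (2 : ℝ) ≤ M := by rw [hMr]; exact_mod_cast hM
  have h1 : Λ ≤ 4 * Real.log (M / δ) := BanditRange.log_ratio_le hτ hk hεk hδ hδ'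
  have hΛ0 : 0 < Λ := by
    refine Real.log_pos ?_
    rw [lt_div_iff₀ (by positivity), one_mul]
    have : ε ^ d ≤ 1 := pow_le_one₀ hε.le (by linarith)
    have hτ' : (1 : ℝ) ≤ τ := by exact_mod_cast hτ
    nlinarith
  have h2 := BanditRange.hardInstance_lower_bound hd (by omega) hε hε' hε1 (by rw [hcard]; exact hM)
    hδ hδ' A hA (S := 1 / 200000 * ((n : ℝ) / ε ^ 2 * Λ)) (by positivity) fun ν => (H ν).le
  rw [hcard, Fintype.card_fin, ← hMr] at h2
  have hnM : (n : ℝ) = (m + 1) * M := by rw [hn, hMr]; push_cast; ring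
  have hm' : (1 : ℝ) ≤ m := by exact_mod_cast hm1
  have h3 : 43 * ε ^ 2 * (4 * (1 / 200000 * ((n : ℝ) / ε ^ 2 * Λ)) / (M * m)) =
      172 / 200000 * Λ * ((m + 1) / m) := by
    rw [hnM]
    have : 0 < M := by linarith
    field_simp
    ring
  have h4 : ((m : ℝ) + 1) / m ≤ 2 := by
    rw [div_le_iff₀ (by linarith)]; linarith
  have h5 := mul_le_mul_of_nonneg_left h4 (show 0 ≤ 172 / 200000 * Λ by positivity)
  rw [h3] at h2
  linarith
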